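/- Let $n\ge 1$. Write elements $\underline{x}$ of $\mathbb R^n$ as columns and elements $\underline{\omega}$ of $\widehat{\mathbb R^n}$ as rows, both with Lebesgue measure. Let $G_n$ be the group of affine maps $[\underline{x},A]:\underline{z}\mapsto \underline{x}+A\underline{z}$ with $\underline{x}\in\mathbb R^n$, $A\in \mathrm{GL}_n(\mathbb R)$, so that $[\underline{x},A][\underline{y},B]=[\underline{x}+A\underline{y},AB]$. Equip $\mathrm{GL}_n(\mathbb R)$ with the Haar measure $d\mu(A)=|\det A|^{-n}\prod_{i,j}da_{ij}$ and $G_n$ with the left Haar measure $|\det A|^{-1}\,d\underline{x}\,d\mu(A)$. Let $\lambda_{G_n}$ be the left regular representation of $G_n$ on $L^2(G_n)$, $\lambda_{G_n}(g)h(k)=h(g^{-1}k)$. Let $\mathcal O_n=\widehat{\mathbb R^n}\setminus\{\underline 0\}$, $\underline{\omega}_0=(1,0,\dots,0)$, and let $\pi^{\underline{\omega}_0}$ be the unitary representation of $G_n$ on $L^2(\mathrm{GL}_n(\mathbb R))$ given by $$\pi^{\underline{\omega}_0}[\underline{x},A]f(B)=e^{2\pi i\,\underline{\omega}_0B^{-1}\underline{x}}f(A^{-1}B).$$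 Fix a measurable map $\gamma:\mathcal O_n\to \mathrm{GL}_n(\mathbb R)$ with $\underline{\omega}_0\gamma(\underline{\omega})^{-1}=\underline{\omega}$ for all $\underline{\omega}\in\mathcal O_n$, and an orthonormal basis $\{\eta_j:j\in J\}$ of $L^2(\widehat{\mathbb R^n})$. **Theorem.** For each $j\in J$ the formula $$U_{\eta_j}f[\underline{y},B]=\int_{\widehat{\mathbb R^n}}\eta_j(\underline{\omega})\,f\big(B\gamma(\underline{\omega})\big)\,e^{-2\pi i\,\underline{\omega}B^{-1}\underline{y}}\,d\underline{\omega}\qquad(f\in L^2(\mathrm{GL}_n(\mathbb R)))$$ defines a linear isometry $U_{\eta_j}:L^2(\mathrm{GL}_n(\mathbb R))\to L^2(G_n)$. Here the integral is understood in the $L^2$ sense: for almost every $B$ the function $\varphi_B(\underline{\omega})=\eta_j(\underline{\omega})f(B\gamma(\underline{\omega}))$ lies in $L^2(\widehat{\mathbb R^n})$, and for almost every $\underline{y}$ the value $U_{\eta_j}f[\underline{y},B]$ is that of the unitary extension to $L^2$ of the transform $\varphi\mapsto\int\varphi(\underline{\omega})e^{-2\pi i\,\underline{\omega}\,\underline{z}}\,d\underline{\omega}$,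 applied to $\varphi_B$, at $\underline{z}=B^{-1}\underline{y}$; this determines $U_{\eta_j}f\in L^2(G_n)$ uniquely, and for almost every $[\underline{y},B]$ for which the integrand is integrable, $U_{\eta_j}f[\underline{y},B]$ equals the integral. Let $\mathcal L_{\eta_j}=U_{\eta_j}L^2(\mathrm{GL}_n(\mathbb R))$. Then each $\mathcal L_{\eta_j}$ is a closed $\lambda_{G_n}$-invariant subspace of $L^2(G_n)$, and $U_{\eta_j}$ intertwines $\pi^{\underline{\omega}_0}$ with the restriction of $\lambda_{G_n}$ to $\mathcal L_{\eta_j}$, that is, $U_{\eta_j}\pi^{\underline{\omega}_0}(g)=\lambda_{G_n}(g)U_{\eta_j}$ for all $g\in G_n$. Moreover $L^2(G_n)$ is the orthogonal (Hilbert space) direct sum $\sum^{\oplus}_{j\in J}\mathcal L_{\eta_j}$. -/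

import Mathlib

open MeasureTheory

noncomputable section

namespace AffineGroup

/-! ### The space `ℝⁿ` and the group `GL_n(ℝ)` with its Haar measure -/

/-- `ℝⁿ` with Lebesgue measure `volume`. It is also used for its dual, the space of row vectors. -/
abbrev Vec (n : ℕ) : Type := EuclideanSpace ℝ (Fin n)

/-- The product `A x` of a matrix and a column vector. -/
def mulCol {n : ℕ} (A : GL (Fin n) ℝ) (x : Vec n) : Vec n :=
  WithLp.toLp 2 (A.val.mulVec x.ofLp)

/-- The product `ω A` of a row vector and a matrix. -/
def rowMul {n : ℕ} (ω : Vec n) (A : GL (Fin n) ℝ) : Vec n :=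
  WithLp.toLp 2 (Matrix.vecMul ω.ofLp A.val)

/-- The product `ω x = ω₁ x₁ + ⋯ + ωₙ xₙ` of a row vector and a column vector. -/
def rowCol {n : ℕ} (ω x : Vec n) : ℝ := dotProduct ω.ofLp x.ofLp

lemma mulCol_one {n : ℕ} (x : Vec n) : mulCol 1 x = x := by simp [mulCol]

lemma mulCol_mul {n : ℕ} (A B : GL (Fin n) ℝ) (x : Vec n) :
    mulCol (A * B) x = mulCol A (mulCol B x) := by simp [mulCol]

lemma mulCol_add {n : ℕ} (A : GL (Fin n) ℝ) (x y : Vec n) :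
    mulCol A (x + y) = mulCol A x + mulCol A y := by simp [mulCol, Matrix.mulVec_add]

lemma mulCol_neg {n : ℕ} (A : GL (Fin n) ℝ) (x : Vec n) :
    mulCol A (-x) = -mulCol A x := by simp [mulCol, Matrix.mulVec_neg]

lemma mulCol_inv_mulCol {n : ℕ} (A : GL (Fin n) ℝ) (x : Vec n) :
    mulCol A⁻¹ (mulCol A x) = x := by rw [← mulCol_mul, inv_mul_cancel, mulCol_one]

lemma mulCol_mulCol_inv {n : ℕ} (A : GL (Fin n) ℝ) (x : Vec n) :
    mulCol A (mulCol A⁻¹ x) = x := by rw [← mulCol_mul, mul_inv_cancel, mulCol_one]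

lemma rowCol_add_right {n : ℕ} (ω x y : Vec n) :
    rowCol ω (x + y) = rowCol ω x + rowCol ω y := by simp [rowCol, dotProduct_add]

/-- The Borel σ-algebra of `GL_n(ℝ)`. -/
instance instMeasurableSpaceGL (n : ℕ) : MeasurableSpace (GL (Fin n) ℝ) := borel _

instance instBorelSpaceGL (n : ℕ) : BorelSpace (GL (Fin n) ℝ) := ⟨rfl⟩

/-- The matrix entries of an element of `GL_n(ℝ)`. -/
def entries (n : ℕ) (A : GL (Fin n) ℝ) : Fin n → Fin n → ℝ := fun i j => A.val i j

lemma isEmbedding_val (n : ℕ) :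
    Topology.IsEmbedding (Units.val : GL (Fin n) ℝ → Matrix (Fin n) (Fin n) ℝ) := by
  refine Units.isEmbedding_val_mk' (f := fun M => M⁻¹) ?_ (fun u => by simp)
  intro A hA
  refine (continuousAt_matrix_inv A ?_).continuousWithinAt
  have h : IsUnit A.det := (Matrix.isUnit_iff_isUnit_det A).1 hA
  obtain ⟨u, hu⟩ := h
  rw [← hu]
  exact NormedRing.inverse_continuousAt u

lemma isEmbedding_entries (n : ℕ) : Topology.IsEmbedding (entries n) :=
  isEmbedding_val n

instance instSecondCountableGL (n : ℕ) : SecondCountableTopology (GL (Fin n) ℝ) :=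
  (isEmbedding_entries n).secondCountableTopology

lemma range_entries (n : ℕ) :
    Set.range (entries n) = {M : Fin n → Fin n → ℝ | (Matrix.of M).det ≠ 0} := by
  ext M
  constructor
  · rintro ⟨A, rfl⟩
    exact ((Matrix.isUnit_iff_isUnit_det A.val).1 A.isUnit).ne_zero
  · intro h
    exact ⟨Matrix.GeneralLinearGroup.mkOfDetNeZero (Matrix.of M) h, rfl⟩

lemma isOpenEmbedding_entries (n : ℕ) : Topology.IsOpenEmbedding (entries n) := by
  refine ⟨isEmbedding_entries n, ?_⟩
  rw [range_entries]
  refine isOpen_ne.preimage (f := fun M : Fin n → Fin n → ℝ => (Matrix.of M).det) ?_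
  exact Continuous.matrix_det (A := fun M : Fin n → Fin n → ℝ => Matrix.of M) continuous_id

lemma measurableEmbedding_entries (n : ℕ) : MeasurableEmbedding (entries n) :=
  (isOpenEmbedding_entries n).measurableEmbedding

/-- `|det A|`, as an extended nonnegative real. -/
def absDet {n : ℕ} (A : GL (Fin n) ℝ) : ENNReal := ENNReal.ofReal |A.val.det|

lemma det_ne_zero {n : ℕ} (A : GL (Fin n) ℝ) : A.val.det ≠ 0 :=
  ((Matrix.isUnit_iff_isUnit_det A.val).1 A.isUnit).ne_zero

lemma absDet_ne_zero {n : ℕ} (A : GL (Fin n) ℝ) : absDet A ≠ 0 := by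
  simp [absDet, det_ne_zero]

lemma absDet_ne_top {n : ℕ} (A : GL (Fin n) ℝ) : absDet A ≠ ⊤ := ENNReal.ofReal_ne_top

lemma absDet_mul {n : ℕ} (A B : GL (Fin n) ℝ) : absDet (A * B) = absDet A * absDet B := by
  simp [absDet, abs_mul, ENNReal.ofReal_mul]

lemma measurable_absDet (n : ℕ) : Measurable (absDet (n := n)) := by
  refine ENNReal.measurable_ofReal.comp (Continuous.measurable ?_)
  exact (Continuous.matrix_det Units.continuous_val).abs

/-- The restriction of Lebesgue measure `∏ da_{ij}` on `ℝ^{n × n}` to `GL_n(ℝ)`. -/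
def lebesgueGL (n : ℕ) : Measure (GL (Fin n) ℝ) :=
  Measure.comap (entries n) (volume : Measure (Fin n → Fin n → ℝ))

/-- The Haar measure `|det A|⁻ⁿ ∏ da_{ij}` of `GL_n(ℝ)`. -/
def haarGL (n : ℕ) : Measure (GL (Fin n) ℝ) :=
  (lebesgueGL n).withDensity fun A => (absDet A ^ n)⁻¹

/-- How a density behaves under a measurable bijection that scales the base measure. -/
lemma map_withDensity_eq {α : Type*} [MeasurableSpace α] (ν : Measure α) {T : α → α}
    (hT : Measurable T) {ρ : α → ENNReal} (hρ : Measurable ρ) {c : ENNReal} (hc0 : c ≠ 0)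
    (hc : c ≠ ⊤) (hν : ν.map T = c⁻¹ • ν) (hTρ : ∀ a, ρ a = c * ρ (T a)) :
    (ν.withDensity ρ).map T = ν.withDensity ρ := by
  ext s hs
  rw [Measure.map_apply hT hs, withDensity_apply _ (hT hs), withDensity_apply _ hs]
  have h1 : ∫⁻ a in T ⁻¹' s, ρ a ∂ν = c * ∫⁻ a in T ⁻¹' s, ρ (T a) ∂ν := by
    rw [← lintegral_const_mul c (f := fun a => ρ (T a)) (hρ.comp hT)]
    exact lintegral_congr fun a => hTρ a
  rw [h1, ← setLIntegral_map hs hρ hT, hν, Measure.restrict_smul, lintegral_smul_measure,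
    smul_eq_mul, ← mul_assoc, ENNReal.mul_inv_cancel hc0 hc, one_mul]

/-- Transposition of matrices preserves Lebesgue measure. -/
lemma map_swap_volume (n : ℕ) :
    (volume : Measure (Fin n → Fin n → ℝ)).map (fun M i j => M j i) = volume := by
  let L : (Fin n → Fin n → ℝ) →ₗ[ℝ] (Fin n → Fin n → ℝ) :=
    { toFun := fun M i j => M j i, map_add' := fun _ _ => rfl, map_smul' := fun _ _ => rfl }
  have hL : L ∘ₗ L = LinearMap.id := rfl
  have hdet : LinearMap.det L * LinearMap.det L = 1 := by
    rw [← LinearMap.det_comp, hL, LinearMap.det_id]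
  have habs : |(LinearMap.det L)⁻¹| = 1 := by
    rcases mul_self_eq_one_iff.1 hdet with h | h <;> simp [h]
  have h := Measure.map_linearMap_addHaar_eq_smul_addHaar
    (volume : Measure (Fin n → Fin n → ℝ)) (f := L) (left_ne_zero_of_mul_eq_one hdet)
  rw [habs, ENNReal.ofReal_one, one_smul] at h
  exact h

/-- Left multiplication by `A`, on arrays of matrix entries. -/
def mulEntries {n : ℕ} (A : GL (Fin n) ℝ) (M : Fin n → Fin n → ℝ) : Fin n → Fin n → ℝ :=
  fun i j => ∑ k, A.val i k * M k j

lemma measurable_mulEntries {n : ℕ} (A : GL (Fin n) ℝ) : Measurable (mulEntries A) := by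
  unfold mulEntries
  fun_prop

lemma entries_mul {n : ℕ} (A B : GL (Fin n) ℝ) :
    entries n (A * B) = mulEntries A (entries n B) := by
  ext i j
  simp [entries, mulEntries, Matrix.mul_apply]

lemma mulEntries_inv_left {n : ℕ} (A : GL (Fin n) ℝ) (M : Fin n → Fin n → ℝ) :
    mulEntries A⁻¹ (mulEntries A M) = M := by
  have h : ∀ (B : GL (Fin n) ℝ) N, mulEntries B N = (B.val * Matrix.of N : Matrix _ _ ℝ) := by
    intro B N
    ext i j
    simp [mulEntries, Matrix.mul_apply]
  rw [h, h]
  change A⁻¹.val * (A.val * Matrix.of M) = Matrix.of M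
  rw [← Matrix.mul_assoc, ← Units.val_mul, inv_mul_cancel, Units.val_one, Matrix.one_mul]

lemma map_mulEntries_volume {n : ℕ} (A : GL (Fin n) ℝ) :
    (volume : Measure (Fin n → Fin n → ℝ)).map (mulEntries A) = (absDet A ^ n)⁻¹ • volume := by
  have hsw : Measurable (fun (M : Fin n → Fin n → ℝ) (i j : Fin n) => M j i) := by fun_prop
  have hA : (volume : Measure (Fin n → ℝ)).map (Matrix.toLin' A.val) = (absDet A)⁻¹ • volume := by
    rw [Real.map_matrix_volume_pi_eq_smul_volume_pi (det_ne_zero A), abs_inv,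
      ENNReal.ofReal_inv_of_pos (abs_pos.2 (det_ne_zero A))]
    rfl
  have hmA : Measurable (Matrix.toLin' A.val) :=
    (LinearMap.continuous_of_finiteDimensional _).measurable
  have hrow : Measurable (fun (M : Fin n → Fin n → ℝ) i => Matrix.toLin' A.val (M i)) :=
    measurable_pi_lambda _ fun i => hmA.comp (measurable_pi_apply i)
  have hfac : mulEntries A = (fun (M : Fin n → Fin n → ℝ) (i j : Fin n) => M j i) ∘
      (fun (M : Fin n → Fin n → ℝ) i => Matrix.toLin' A.val (M i)) ∘
      (fun (M : Fin n → Fin n → ℝ) (i j : Fin n) => M j i) := by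
    ext M i j
    simp [mulEntries, Matrix.mulVec, dotProduct]
  have hsf : SigmaFinite ((volume : Measure (Fin n → ℝ)).map (Matrix.toLin' A.val)) := by
    rw [hA]
    obtain ⟨c, hc⟩ := WithTop.ne_top_iff_exists.1 (ENNReal.inv_ne_top.2 (absDet_ne_zero A))
    rw [← hc]
    exact inferInstanceAs (SigmaFinite (c • (volume : Measure (Fin n → ℝ))))
  have hpi : (volume : Measure (Fin n → Fin n → ℝ)).map
      (fun M i => Matrix.toLin' A.val (M i)) = (absDet A ^ n)⁻¹ • volume := by
    have h := Measure.pi_map_pi (ι := Fin n) (μ := fun _ => (volume : Measure (Fin n → ℝ)))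
      (f := fun _ => Matrix.toLin' A.val) (hμ := fun _ => hsf) fun _ => hmA.aemeasurable
    refine h.trans ?_
    refine Measure.pi_eq fun s hs => ?_
    rw [hA]
    simp only [Measure.smul_apply, smul_eq_mul]
    rw [Finset.prod_mul_distrib, Finset.prod_const, Finset.card_univ, Fintype.card_fin,
      ENNReal.inv_pow, volume_pi_pi]
  rw [hfac, ← Measure.map_map hsw (hrow.comp hsw), ← Measure.map_map hrow hsw, map_swap_volume,
    hpi, Measure.map_smul, map_swap_volume]

lemma map_mul_lebesgueGL {n : ℕ} (A : GL (Fin n) ℝ) :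
    (lebesgueGL n).map (A * ·) = (absDet A ^ n)⁻¹ • lebesgueGL n := by
  have hm : Measurable (fun B : GL (Fin n) ℝ => A * B) := (continuous_const_mul A).measurable
  have he := measurableEmbedding_entries n
  ext s hs
  rw [Measure.map_apply hm hs, Measure.smul_apply, lebesgueGL, he.comap_apply, he.comap_apply,
    ← Measure.smul_apply, ← map_mulEntries_volume,
    Measure.map_apply (measurable_mulEntries A) (he.measurableSet_image.2 hs)]
  congr 1
  ext M
  constructor
  · rintro ⟨B, hB, rfl⟩
    exact ⟨A * B, hB, entries_mul A B⟩
  · rintro ⟨B, hB, h⟩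
    refine ⟨A⁻¹ * B, by simpa using hB, ?_⟩
    rw [entries_mul, h, mulEntries_inv_left]

instance instIsMulLeftInvariantHaarGL (n : ℕ) : (haarGL n).IsMulLeftInvariant where
  map_mul_left_eq_self A := by
    refine map_withDensity_eq _ (continuous_const_mul A).measurable
      ((measurable_absDet n).pow_const n).inv (pow_ne_zero n (absDet_ne_zero A))
      (ENNReal.pow_ne_top (absDet_ne_top A)) (map_mul_lebesgueGL A) fun B => ?_
    rw [absDet_mul, mul_pow, ENNReal.mul_inv (Or.inl (pow_ne_zero n (absDet_ne_zero A)))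
      (Or.inl (ENNReal.pow_ne_top (absDet_ne_top A))), ← mul_assoc,
      ENNReal.mul_inv_cancel (pow_ne_zero n (absDet_ne_zero A))
      (ENNReal.pow_ne_top (absDet_ne_top A)), one_mul]

instance instSigmaFiniteHaarGL (n : ℕ) : SigmaFinite (haarGL n) := by
  have h : SigmaFinite (lebesgueGL n) := by
    have : LocallyCompactSpace (GL (Fin n) ℝ) := (isOpenEmbedding_entries n).locallyCompactSpace
    have : IsFiniteMeasureOnCompacts (lebesgueGL n) :=
      .comap' _ (isOpenEmbedding_entries n).continuous (measurableEmbedding_entries n)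
    infer_instance
  refine SigmaFinite.withDensity_of_ne_top ?_
  exact Filter.Eventually.of_forall fun A => ENNReal.inv_ne_top.2 (pow_ne_zero n (absDet_ne_zero A))

/-! ### The affine group `G_n` with its Haar measure -/

/-- The affine transformation `[x, A] : z ↦ x + A z` of `ℝⁿ`. -/
@[ext]
structure Aff (n : ℕ) where
  vec : Vec n
  lin : GL (Fin n) ℝ

namespace Aff

variable {n : ℕ}

/-- `[x, A]` as a map of `ℝⁿ`. -/
def toMap (g : Aff n) (z : Vec n) : Vec n := g.vec + mulCol g.lin z

/-- The group law is the composition of maps, `[x, A][y, B] = [x + A y, A B]`. -/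
instance instMul : Mul (Aff n) := ⟨fun g h => ⟨g.vec + mulCol g.lin h.vec, g.lin * h.lin⟩⟩

instance instOne : One (Aff n) := ⟨⟨0, 1⟩⟩

instance instInv : Inv (Aff n) := ⟨fun g => ⟨-mulCol g.lin⁻¹ g.vec, g.lin⁻¹⟩⟩

lemma mul_vec (g h : Aff n) : (g * h).vec = g.vec + mulCol g.lin h.vec := rfl

lemma mul_lin (g h : Aff n) : (g * h).lin = g.lin * h.lin := rfl

lemma one_vec : (1 : Aff n).vec = 0 := rfl

lemma one_lin : (1 : Aff n).lin = 1 := rfl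

lemma inv_vec (g : Aff n) : g⁻¹.vec = -mulCol g.lin⁻¹ g.vec := rfl

lemma inv_lin (g : Aff n) : g⁻¹.lin = g.lin⁻¹ := rfl

lemma toMap_mul (g h : Aff n) (z : Vec n) : (g * h).toMap z = g.toMap (h.toMap z) := by
  simp [toMap, mul_vec, mul_lin, mulCol_add, mulCol_mul, add_assoc]

instance instGroup : Group (Aff n) :=
  Group.ofLeftAxioms
    (fun g h k => by
      ext1
      · simp [mul_vec, mul_lin, mulCol_add, mulCol_mul, add_assoc]
      · simp [mul_lin, mul_assoc])
    (fun g => by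
      ext1
      · simp [mul_vec, one_vec, one_lin, mulCol_one]
      · simp [mul_lin, one_lin])
    (fun g => by
      ext1
      · simp [mul_vec, inv_vec, inv_lin, one_vec]
      · simp [mul_lin, inv_lin, one_lin])

/-- The identification of the space `G_n` with `ℝⁿ × GL_n(ℝ)`. -/
def equivProd (n : ℕ) : Aff n ≃ Vec n × GL (Fin n) ℝ where
  toFun g := (g.vec, g.lin)
  invFun p := ⟨p.1, p.2⟩
  left_inv _ := rfl
  right_inv _ := rfl

instance instTopologicalSpace : TopologicalSpace (Aff n) :=
  TopologicalSpace.induced (equivProd n) inferInstance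

instance instMeasurableSpace : MeasurableSpace (Aff n) := borel _

instance instBorelSpace : BorelSpace (Aff n) := ⟨rfl⟩

/-- `equivProd` as a homeomorphism. -/
def homeoProd (n : ℕ) : Aff n ≃ₜ Vec n × GL (Fin n) ℝ :=
  (equivProd n).toHomeomorphOfIsInducing ⟨rfl⟩

/-- `equivProd` as an isomorphism of measurable spaces. -/
def measurableEquivProd (n : ℕ) : Aff n ≃ᵐ Vec n × GL (Fin n) ℝ := (homeoProd n).toMeasurableEquiv

end Aff

lemma continuous_mulCol {n : ℕ} (A : GL (Fin n) ℝ) : Continuous (mulCol A) :=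
  LinearMap.continuous_of_finiteDimensional (Matrix.toEuclideanLin A.val)

/-- Left translation by `[x, A]`, in the coordinates `ℝⁿ × GL_n(ℝ)`. -/
def transProd {n : ℕ} (g : Aff n) : Vec n × GL (Fin n) ℝ → Vec n × GL (Fin n) ℝ :=
  Prod.map (fun y => g.vec + mulCol g.lin y) (fun B => g.lin * B)

lemma measurable_transProd {n : ℕ} (g : Aff n) : Measurable (transProd g) :=
  Measurable.prodMap (continuous_const.add (continuous_mulCol g.lin)).measurable
    (continuous_const_mul g.lin).measurable

lemma continuous_mulCol_uncurry {n : ℕ} {X : Type*} [TopologicalSpace X]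
    {A : X → GL (Fin n) ℝ} {x : X → Vec n} (hA : Continuous A) (hx : Continuous x) :
    Continuous fun a => mulCol (A a) (x a) := by
  unfold mulCol
  have h1 : Continuous fun a => (A a).val := Units.continuous_val.comp hA
  have h2 : Continuous fun a => (x a).ofLp := (PiLp.continuous_ofLp 2 _).comp hx
  exact (PiLp.continuous_toLp 2 _).comp (h1.matrix_mulVec h2)

lemma continuous_vec (n : ℕ) : Continuous (Aff.vec : Aff n → Vec n) :=
  continuous_fst.comp (Aff.homeoProd n).continuous

lemma continuous_lin (n : ℕ) : Continuous (Aff.lin : Aff n → GL (Fin n) ℝ) :=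
  continuous_snd.comp (Aff.homeoProd n).continuous

instance instIsTopologicalGroupAff (n : ℕ) : IsTopologicalGroup (Aff n) where
  continuous_mul := by
    have h1 := (continuous_vec n).comp (continuous_fst (X := Aff n) (Y := Aff n))
    have h2 := (continuous_lin n).comp (continuous_fst (X := Aff n) (Y := Aff n))
    have h3 := (continuous_vec n).comp (continuous_snd (X := Aff n) (Y := Aff n))
    have h4 := (continuous_lin n).comp (continuous_snd (X := Aff n) (Y := Aff n))
    exact (Aff.homeoProd n).symm.continuous.comp
      ((h1.add (continuous_mulCol_uncurry h2 h3)).prodMk (h2.mul h4))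
  continuous_inv := by
    have h := (continuous_lin n).inv
    exact (Aff.homeoProd n).symm.continuous.comp
      ((continuous_mulCol_uncurry h (continuous_vec n)).neg.prodMk h)

/-- The left Haar measure `|det A|⁻¹ dx dμ(A)` of `G_n`, where `μ` is the Haar measure of
`GL_n(ℝ)`. -/
def haarAff (n : ℕ) : Measure (Aff n) :=
  (((volume : Measure (Vec n)).prod (haarGL n)).withDensity fun p => (absDet p.2)⁻¹).map
    (Aff.equivProd n).symm

lemma map_affine_volume {n : ℕ} (x : Vec n) (A : GL (Fin n) ℝ) :
    (volume : Measure (Vec n)).map (fun y => x + mulCol A y) = (absDet A)⁻¹ • volume := by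
  have h := Measure.map_linearMap_addHaar_eq_smul_addHaar (volume : Measure (Vec n))
    (f := Matrix.toEuclideanLin A.val) (by simpa using det_ne_zero A)
  have h2 : (volume : Measure (Vec n)).map (mulCol A) = (absDet A)⁻¹ • volume := by
    refine h.trans ?_
    congr 1
    rw [absDet, ← ENNReal.ofReal_inv_of_pos (abs_pos.2 (det_ne_zero A)), abs_inv]
    simp
  have h3 : (fun y => x + mulCol A y) = (fun y => x + y) ∘ mulCol A := rfl
  rw [h3, ← Measure.map_map (measurable_const_add x) (continuous_mulCol A).measurable, h2,
    Measure.map_smul, map_add_left_eq_self]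

instance instIsMulLeftInvariantHaarAff (n : ℕ) : (haarAff n).IsMulLeftInvariant where
  map_mul_left_eq_self g := by
    have hs : Measurable (Aff.equivProd n).symm := (Aff.measurableEquivProd n).symm.measurable
    have hcomp : (fun h : Aff n => g * h) ∘ (Aff.equivProd n).symm =
        (Aff.equivProd n).symm ∘ transProd g := rfl
    rw [haarAff, Measure.map_map (continuous_const_mul g).measurable hs, hcomp,
      ← Measure.map_map hs (measurable_transProd g)]
    congr 1
    refine map_withDensity_eq _ (measurable_transProd g)
      ((measurable_absDet n).comp measurable_snd).inv (absDet_ne_zero g.lin)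
      (absDet_ne_top g.lin) ?_ fun p => ?_
    · rw [transProd, ← Measure.map_prod_map _ _
        (f := fun y => g.vec + mulCol g.lin y)
        (continuous_const.add (continuous_mulCol g.lin)).measurable
        (continuous_const_mul g.lin).measurable, map_affine_volume, map_mul_left_eq_self,
        Measure.prod_smul_left]
    · change (absDet p.2)⁻¹ = absDet g.lin * (absDet (g.lin * p.2))⁻¹
      rw [absDet_mul, ENNReal.mul_inv (Or.inl (absDet_ne_zero _)) (Or.inl (absDet_ne_top _)),
        ← mul_assoc, ENNReal.mul_inv_cancel (absDet_ne_zero _) (absDet_ne_top _), one_mul]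

/-! ### The Hilbert spaces and the representations -/

/-- `L²` of the dual of `ℝⁿ`. -/
abbrev L2Vec (n : ℕ) : Type := Lp ℂ 2 (volume : Measure (Vec n))

/-- `L²(GL_n(ℝ))`. -/
abbrev L2GL (n : ℕ) : Type := Lp ℂ 2 (haarGL n)

/-- `L²(G_n)`. -/
abbrev L2Aff (n : ℕ) : Type := Lp ℂ 2 (haarAff n)

/-- The character `t ↦ e^{2πit}` of `ℝ`. -/
def e (t : ℝ) : ℂ := Complex.exp ((2 * Real.pi * t : ℝ) * Complex.I)

lemma norm_e (t : ℝ) : ‖e t‖ = 1 := Complex.norm_exp_ofReal_mul_I _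

lemma e_zero : e 0 = 1 := by simp [e]

lemma e_add (s t : ℝ) : e (s + t) = e s * e t := by
  rw [e, e, e, ← Complex.exp_add]
  congr 1
  push_cast
  ring

lemma continuous_e : Continuous e := by
  unfold e
  fun_prop

lemma memLp_mul {α : Type*} [MeasurableSpace α] {μ : Measure α} {c : α → ℂ} (hc : Measurable c)
    (hn : ∀ a, ‖c a‖ = 1) (f : Lp ℂ 2 μ) : MemLp (fun a => c a * f a) 2 μ :=
  (Lp.memLp f).of_le (hc.aestronglyMeasurable.mul (Lp.aestronglyMeasurable f))
    (Filter.Eventually.of_forall fun a => by simp [hn a])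

/-- Multiplication by a measurable function of absolute value one, on `L²`. -/
def mulUnimodular {α : Type*} [MeasurableSpace α] (μ : Measure α) (c : α → ℂ) (hc : Measurable c)
    (hn : ∀ a, ‖c a‖ = 1) : Lp ℂ 2 μ →ₗᵢ[ℂ] Lp ℂ 2 μ where
  toFun f := (memLp_mul hc hn f).toLp (fun a => c a * f a)
  map_add' f g := by
    rw [← MemLp.toLp_add]
    refine MemLp.toLp_congr _ _ ?_
    filter_upwards [Lp.coeFn_add f g] with a ha
    rw [ha, Pi.add_apply, mul_add, Pi.add_apply]
  map_smul' r f := by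
    rw [RingHom.id_apply, ← MemLp.toLp_const_smul]
    refine MemLp.toLp_congr _ _ ?_
    filter_upwards [Lp.coeFn_smul r f] with a ha
    rw [ha, Pi.smul_apply, Pi.smul_apply, smul_eq_mul, smul_eq_mul, mul_left_comm]
  norm_map' f := by
    refine congrArg ENNReal.toReal (eLpNorm_congr_norm_ae ?_)
    filter_upwards [MemLp.coeFn_toLp (memLp_mul hc hn f)] with a ha
    exact (congrArg norm ha).trans (by rw [norm_mul, hn a, one_mul])

/-- A family of isometries of a Hilbert space that respects the group law, as a homomorphism into
the group of unitary operators. -/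
def unitaryRep {G H : Type*} [Group G] [NormedAddCommGroup H] [InnerProductSpace ℂ H]
    (T : G → H →ₗᵢ[ℂ] H) (h1 : ∀ f, T 1 f = f) (hT : ∀ g h f, T (g * h) f = T g (T h f)) :
    G →* (H ≃ₗᵢ[ℂ] H) where
  toFun g :=
    { toLinearEquiv := LinearEquiv.ofLinearMap (T g).toLinearMap (T g⁻¹).toLinearMap
        (LinearMap.ext fun f => by simpa [h1] using (hT g g⁻¹ f).symm)
        (LinearMap.ext fun f => by simpa [h1] using (hT g⁻¹ g f).symm)
      norm_map' := fun f => (T g).norm_map f }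
  map_one' := LinearIsometryEquiv.ext h1
  map_mul' g h := LinearIsometryEquiv.ext (hT g h)

/-- `f ↦ f(g⁻¹ ·)` on `L²(G_n)`. -/
def leftTranslate {n : ℕ} (g : Aff n) : L2Aff n →ₗᵢ[ℂ] L2Aff n :=
  Lp.compMeasurePreservingₗᵢ ℂ (fun h => g⁻¹ * h) (measurePreserving_mul_left (haarAff n) g⁻¹)

lemma leftTranslate_ae {n : ℕ} (g : Aff n) (f : L2Aff n) :
    leftTranslate g f =ᵐ[haarAff n] fun h => f (g⁻¹ * h) :=
  Lp.coeFn_compMeasurePreserving f (measurePreserving_mul_left (haarAff n) g⁻¹)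

/-- The left regular representation of `G_n` on `L²(G_n)`, `(λ(g) f)(h) = f(g⁻¹ h)`. -/
def leftRegular (n : ℕ) : Aff n →* (L2Aff n ≃ₗᵢ[ℂ] L2Aff n) :=
  unitaryRep leftTranslate
    (fun f => by
      refine Lp.ext ((leftTranslate_ae 1 f).trans ?_)
      simp)
    (fun g h f => by
      refine Lp.ext ((leftTranslate_ae (g * h) f).trans ?_)
      refine Filter.EventuallyEq.trans ?_ (leftTranslate_ae g (leftTranslate h f)).symm
      have hq := (measurePreserving_mul_left (haarAff n) g⁻¹).quasiMeasurePreserving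
      filter_upwards [hq.ae (leftTranslate_ae h f)] with k hk
      rw [hk, mul_inv_rev, mul_assoc])

lemma continuous_phase {n : ℕ} (ω x : Vec n) :
    Continuous fun B : GL (Fin n) ℝ => e (rowCol ω (mulCol B⁻¹ x)) := by
  refine continuous_e.comp ?_
  unfold rowCol mulCol
  have h : Continuous fun B : GL (Fin n) ℝ => (B⁻¹).val :=
    Units.continuous_val.comp continuous_inv
  exact Continuous.dotProduct continuous_const (h.matrix_mulVec continuous_const)

/-- `f ↦ e^{2πi ω B⁻¹ x} f(A⁻¹ B)` on `L²(GL_n(ℝ))`, for `g = [x, A]`. -/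
def piOp {n : ℕ} (ω : Vec n) (g : Aff n) : L2GL n →ₗᵢ[ℂ] L2GL n :=
  (mulUnimodular (haarGL n) (fun B => e (rowCol ω (mulCol B⁻¹ g.vec)))
    (continuous_phase ω g.vec).measurable (fun _ => norm_e _)).comp
  (Lp.compMeasurePreservingₗᵢ ℂ (fun B => g.lin⁻¹ * B)
    (measurePreserving_mul_left (haarGL n) g.lin⁻¹))

lemma piOp_ae {n : ℕ} (ω : Vec n) (g : Aff n) (f : L2GL n) :
    piOp ω g f =ᵐ[haarGL n] fun B => e (rowCol ω (mulCol B⁻¹ g.vec)) * f (g.lin⁻¹ * B) := by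
  refine (MemLp.coeFn_toLp (memLp_mul (continuous_phase ω g.vec).measurable (fun _ => norm_e _)
    (Lp.compMeasurePreservingₗᵢ ℂ (fun B => g.lin⁻¹ * B)
      (measurePreserving_mul_left (haarGL n) g.lin⁻¹) f))).trans ?_
  filter_upwards [Lp.coeFn_compMeasurePreserving f
    (measurePreserving_mul_left (haarGL n) g.lin⁻¹)] with B hB
  exact congrArg _ hB

/-- The representation `π^ω` of `G_n` on `L²(GL_n(ℝ))`,
`(π^ω[x, A] f)(B) = e^{2πi ω B⁻¹ x} f(A⁻¹ B)`. -/
def piRep {n : ℕ} (ω : Vec n) : Aff n →* (L2GL n ≃ₗᵢ[ℂ] L2GL n) :=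
  unitaryRep (piOp ω)
    (fun f => by
      refine Lp.ext ((piOp_ae ω 1 f).trans ?_)
      have h0 : ∀ B : GL (Fin n) ℝ, rowCol ω (mulCol B⁻¹ 0) = 0 := by simp [rowCol, mulCol]
      simp [Aff.one_vec, Aff.one_lin, h0, e_zero])
    (fun g h f => by
      refine Lp.ext ((piOp_ae ω (g * h) f).trans ?_)
      refine Filter.EventuallyEq.trans ?_ (piOp_ae ω g (piOp ω h f)).symm
      have hq := (measurePreserving_mul_left (haarGL n) g.lin⁻¹).quasiMeasurePreserving
      filter_upwards [hq.ae (piOp_ae ω h f)] with B hB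
      rw [hB, Aff.mul_vec, Aff.mul_lin, mulCol_add, rowCol_add_right, e_add, mul_inv_rev,
        mul_inv_rev, inv_inv, mulCol_mul, mul_assoc, mul_assoc])

/-! ### The partial Fourier integrals -/

/-- The row vector `ω₀ = (1, 0, …, 0)`. -/
def omega0 (n : ℕ) [NeZero n] : Vec n := EuclideanSpace.single 0 1

/-- The open orbit of the nonzero row vectors. -/
def orbit (n : ℕ) : Set (Vec n) := {ω | ω ≠ 0}

/-- Lebesgue measure on the orbit. -/
def volumeOrbit (n : ℕ) : Measure (orbit n) := (volume : Measure (Vec n)).comap Subtype.val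

/-- The integrand `η(ω) f(B γ(ω)) e^{-2πi ω B⁻¹ y}` of `U_η f[y, B]`. -/
def integrand {n : ℕ} (γ : orbit n → GL (Fin n) ℝ) (η : L2Vec n) (f : L2GL n) (g : Aff n)
    (ω : orbit n) : ℂ :=
  η ω * f (g.lin * γ ω) * e (-rowCol ω (mulCol g.lin⁻¹ g.vec))

/-- `h` is the partial Fourier integral
`h[y, B] = ∫ η(ω) f(B γ(ω)) e^{-2πi ω B⁻¹ y} dω`, in the `L²` sense: for almost every `B`, the
function `φ(ω) = η(ω) f(B γ(ω))` is in `L²`, and `h[y, B] = (𝓕 φ)(B⁻¹ y)` for almost every `y`.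
Here `𝓕` is the unitary extension to `L²` of `𝓕 φ(z) = ∫ φ(ω) e^{-2πi ω z} dω`. -/
def IsPartialFourierIntegral {n : ℕ} (γ : orbit n → GL (Fin n) ℝ) (η : L2Vec n) (f : L2GL n)
    (h : L2Aff n) : Prop :=
  ∀ᵐ B ∂haarGL n, ∃ φ : L2Vec n,
    (∀ᵐ ω : orbit n ∂volumeOrbit n, φ ω = η ω * f (B * γ ω)) ∧
    ∀ᵐ y : Vec n, h ⟨y, B⟩ = Lp.fourierTransformₗᵢ (Vec n) ℂ φ (mulCol B⁻¹ y)

end AffineGroup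

end

open AffineGroup

noncomputable section

namespace AffineGroup

/-! ### Orthonormal bases and Hilbert sums -/

/-! In the coordinates `[y, B] ↦ (B⁻¹ y, B)` the Jacobian of `y ↦ B⁻¹ y` cancels the factor `|det
B|⁻¹` of the Haar measure, so `L²(G_n)` becomes `L²` of the plain product `ℝⁿ × GL_n(ℝ)`
(`measurePreserving_untwist`). There `U_η f` arises from `η ⊗ f` in two steps: composition with the
shear `(ω, B) ↦ (ω, B γ(ω))`, which preserves the measure because `GL_n(ℝ)` is unimodular
(`measurePreserving_shear`), and the Fourier transform in the first variable. All these operations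
are unitary and independent of `η`, so `U_η f = W (η ⊗ f)` for a single unitary `W`
(`exists_isometry_isPartialFourierIntegral`). Since `L²` of the product is the Hilbert sum of the
spaces `η_j ⊗ L²(GL_n(ℝ))` (`isHilbertSum_tensorLeft`), applying `W` gives the decomposition;
isometry and closed range come with it.

For the intertwining relation, `ω₀ γ(ω)⁻¹ = ω` turns the phase of `π^{ω₀}[x, A]` at `B γ(ω)` into
`e^{2πi ω B⁻¹ x}`. The Fourier transform converts this modulation into translation by `B⁻¹ x`, which
is left translation in `G_n` (`IsPartialFourierIntegral.piRep`).

The partial Fourier transform is built as `T ⊗ 1` by moving an orthonormal basis, and its action on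
sections is read off from coefficients (`exists_section_isometry`). Countability of orthonormal
families in a separable space allows one null set to serve for all coefficients. -/

lemma countable_of_orthonormal {ι H : Type*} [NormedAddCommGroup H] [InnerProductSpace ℂ H]
    [TopologicalSpace.SeparableSpace H] {v : ι → H} (hv : Orthonormal ℂ v) : Countable ι := by
  refine Pairwise.countable_of_isOpen_disjoint (s := fun i => Metric.ball (v i) (1 / 2)) ?_
    (fun i => Metric.isOpen_ball) (fun i => ⟨v i, Metric.mem_ball_self (by norm_num)⟩)
  intro i j hij
  refine Metric.ball_disjoint_ball ?_
  -- Distinct vectors are at distance `√2 > 1`, so the balls of radius `1/2` are disjoint.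
  have h2 : ‖v i - v j‖ ^ 2 = 2 := by
    rw [@norm_sub_sq ℂ, hv.1 i, hv.1 j, hv.2 hij]
    norm_num
  rw [dist_eq_norm]
  nlinarith [norm_nonneg (v i - v j)]

/-- The image of an orthonormal basis under a unitary operator. -/
def HilbertBasis.mapIsometry {ι H K : Type*} [NormedAddCommGroup H] [InnerProductSpace ℂ H]
    [NormedAddCommGroup K] [InnerProductSpace ℂ K] (b : HilbertBasis ι ℂ H) (T : H ≃ₗᵢ[ℂ] K) :
    HilbertBasis ι ℂ K :=
  HilbertBasis.ofRepr (T.symm.trans b.repr)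

lemma HilbertBasis.mapIsometry_apply {ι H K : Type*} [NormedAddCommGroup H]
    [InnerProductSpace ℂ H] [NormedAddCommGroup K] [InnerProductSpace ℂ K]
    (b : HilbertBasis ι ℂ H) (T : H ≃ₗᵢ[ℂ] K) (i : ι) :
    HilbertBasis.mapIsometry b T i = T (b i) := by
  classical
  rw [← HilbertBasis.repr_symm_single, ← HilbertBasis.repr_symm_single]
  rfl

lemma HilbertBasis.ext_inner {ι H : Type*} [NormedAddCommGroup H] [InnerProductSpace ℂ H]
    (b : HilbertBasis ι ℂ H) {x y : H} (h : ∀ i, inner ℂ (b i) x = inner ℂ (b i) y) : x = y := by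
  refine b.repr.injective (lp.ext (funext fun i => ?_))
  rw [b.repr_apply_apply, b.repr_apply_apply, h]

/-- Two Hilbert sums of the same family are unitarily equivalent. -/
def IsHilbertSum.equiv {ι H K : Type*} {G : ι → Type*} [∀ i, NormedAddCommGroup (G i)]
    [∀ i, InnerProductSpace ℂ (G i)] [NormedAddCommGroup H] [InnerProductSpace ℂ H]
    [CompleteSpace H] [NormedAddCommGroup K] [InnerProductSpace ℂ K] [CompleteSpace K]
    {V : ∀ i, G i →ₗᵢ[ℂ] H} {W : ∀ i, G i →ₗᵢ[ℂ] K} (hV : IsHilbertSum ℂ G V)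
    (hW : IsHilbertSum ℂ G W) : H ≃ₗᵢ[ℂ] K :=
  hV.linearIsometryEquiv.trans hW.linearIsometryEquiv.symm

lemma IsHilbertSum.equiv_apply {ι H K : Type*} {G : ι → Type*} [∀ i, NormedAddCommGroup (G i)]
    [∀ i, InnerProductSpace ℂ (G i)] [NormedAddCommGroup H] [InnerProductSpace ℂ H]
    [CompleteSpace H] [NormedAddCommGroup K] [InnerProductSpace ℂ K] [CompleteSpace K]
    {V : ∀ i, G i →ₗᵢ[ℂ] H} {W : ∀ i, G i →ₗᵢ[ℂ] K} (hV : IsHilbertSum ℂ G V)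
    (hW : IsHilbertSum ℂ G W) (i : ι) (x : G i) : IsHilbertSum.equiv hV hW (V i x) = W i x := by
  classical
  rw [IsHilbertSum.equiv, LinearIsometryEquiv.trans_apply,
    ← hV.linearIsometryEquiv_symm_apply_single, LinearIsometryEquiv.apply_symm_apply,
    hW.linearIsometryEquiv_symm_apply_single]

/-- A unitary operator carries a Hilbert sum to the Hilbert sum of the ranges of the images. -/
lemma isHilbertSum_range_comp {ι H K : Type*} {G : ι → Type*} [∀ i, NormedAddCommGroup (G i)]
    [∀ i, InnerProductSpace ℂ (G i)] [∀ i, CompleteSpace (G i)] [NormedAddCommGroup H]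
    [InnerProductSpace ℂ H] [CompleteSpace H] [NormedAddCommGroup K] [InnerProductSpace ℂ K]
    [CompleteSpace K] {V : ∀ i, G i →ₗᵢ[ℂ] H} (hV : IsHilbertSum ℂ G V) (W : H ≃ₗᵢ[ℂ] K)
    {U : ∀ i, G i →ₗᵢ[ℂ] K} (hU : ∀ i x, U i x = W (V i x)) :
    IsHilbertSum ℂ (fun i => LinearMap.range (U i).toLinearMap)
      (fun i => (LinearMap.range (U i).toLinearMap).subtypeₗᵢ) := by
  have hc : ∀ i, CompleteSpace (LinearMap.range (U i).toLinearMap) := fun i =>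
    (U i).isometry.isUniformInducing.isComplete_range.completeSpace_coe
  refine IsHilbertSum.mkInternal _ ?_ ?_
  · rintro i j hij ⟨_, x, rfl⟩ ⟨_, y, rfl⟩
    change inner ℂ (U i x) (U j y) = 0
    rw [hU, hU, W.inner_map_map]
    exact hV.OrthogonalFamily hij x y
  · intro k _
    -- Expand `W⁻¹ k` along the `V i` and apply `W`: the partial sums lie in the algebraic sum of
    -- the ranges and converge to `k`.
    obtain ⟨w, hw⟩ := hV.linearIsometryEquiv.symm.surjective (W.symm k)
    have hs := (hV.hasSum_linearIsometryEquiv_symm w).mapL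
      W.toContinuousLinearEquiv.toContinuousLinearMap
    rw [hw] at hs
    have hs' : HasSum (fun i => U i (w i)) k := by
      convert hs using 1
      · funext i
        exact hU i (w i)
      · exact (W.apply_symm_apply k).symm
    refine mem_closure_of_tendsto hs' (Filter.Eventually.of_forall fun s => ?_)
    exact Submodule.sum_mem _ fun i _ => Submodule.mem_iSup_of_mem i ⟨w i, rfl⟩

/-! ### Tensor products of square integrable functions -/

section Tensor

variable {X Y : Type*} [MeasurableSpace X] [MeasurableSpace Y] {μ : Measure X} {ν : Measure Y}
  [SFinite μ] [SFinite ν]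

omit [SFinite μ] [SFinite ν] in
lemma memLp_tensor (a : Lp ℂ 2 μ) (b : Lp ℂ 2 ν) :
    MemLp (fun p : X × Y => a p.1 * b p.2) 2 (μ.prod ν) := by
  have hm : AEStronglyMeasurable (fun p : X × Y => a p.1 * b p.2) (μ.prod ν) :=
    ((Lp.stronglyMeasurable a).comp_fst.mul (Lp.stronglyMeasurable b).comp_snd).aestronglyMeasurable
  refine (memLp_two_iff_integrable_sq_norm hm).2 ?_
  have h := ((memLp_two_iff_integrable_sq_norm (Lp.aestronglyMeasurable a)).1 (Lp.memLp a)).mul_prod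
    ((memLp_two_iff_integrable_sq_norm (Lp.aestronglyMeasurable b)).1 (Lp.memLp b))
  simpa only [norm_mul, mul_pow] using h

/-- The function `(x, y) ↦ a(x) b(y)`. -/
def tensor (a : Lp ℂ 2 μ) (b : Lp ℂ 2 ν) : Lp ℂ 2 (μ.prod ν) := (memLp_tensor a b).toLp _

omit [SFinite μ] [SFinite ν] in
lemma tensor_ae (a : Lp ℂ 2 μ) (b : Lp ℂ 2 ν) :
    tensor a b =ᵐ[μ.prod ν] fun p => a p.1 * b p.2 := (memLp_tensor a b).coeFn_toLp

/-- The integral of a product of functions of separate variables factors. This gives both the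
isometry of `b ↦ a ⊗ b` for a unit vector `a` and the orthogonality of distinct summands. -/
lemma inner_tensor (a a' : Lp ℂ 2 μ) (b b' : Lp ℂ 2 ν) :
    inner ℂ (tensor a b) (tensor a' b') = inner ℂ a a' * inner ℂ b b' := by
  rw [L2.inner_def, L2.inner_def, L2.inner_def, ← integral_prod_mul]
  refine integral_congr_ae ?_
  filter_upwards [tensor_ae a b, tensor_ae a' b'] with p h h'
  rw [h, h']
  simp only [RCLike.inner_apply, map_mul]
  ring

/-- `b ↦ a ⊗ b`, for a unit vector `a`. -/
def tensorLeft (ν : Measure Y) [SFinite ν] (a : Lp ℂ 2 μ) (ha : ‖a‖ = 1) :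
    Lp ℂ 2 ν →ₗᵢ[ℂ] Lp ℂ 2 (μ.prod ν) where
  toFun := tensor a
  map_add' b c := by
    refine Lp.ext ?_
    filter_upwards [tensor_ae a (b + c), tensor_ae a b, tensor_ae a c,
      Lp.coeFn_add (tensor a b) (tensor a c),
      Measure.quasiMeasurePreserving_snd.ae (Lp.coeFn_add b c)] with p h1 h2 h3 h4 h5
    rw [h1, h4, Pi.add_apply, h2, h3, h5, Pi.add_apply, mul_add]
  map_smul' r b := by
    refine Lp.ext ?_
    filter_upwards [tensor_ae a (r • b), tensor_ae a b, Lp.coeFn_smul r (tensor a b),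
      Measure.quasiMeasurePreserving_snd.ae (Lp.coeFn_smul r b)] with p h1 h2 h4 h5
    rw [h1, RingHom.id_apply, h4, Pi.smul_apply, h2, h5, Pi.smul_apply, smul_eq_mul, smul_eq_mul,
      mul_left_comm]
  norm_map' b := by
    change ‖tensor a b‖ = ‖b‖
    have h : ((‖tensor a b‖ ^ 2 : ℝ) : ℂ) = ((‖b‖ ^ 2 : ℝ) : ℂ) := by
      push_cast
      have h1 := inner_tensor a a b b
      rw [inner_self_eq_norm_sq_to_K, inner_self_eq_norm_sq_to_K, inner_self_eq_norm_sq_to_K,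
        ha] at h1
      simpa using h1
    exact (sq_eq_sq₀ (norm_nonneg _) (norm_nonneg _)).1 (by exact_mod_cast h)

/-- Almost all sections of a square integrable function are square integrable. -/
lemma memLp_section (Φ : Lp ℂ 2 (μ.prod ν)) : ∀ᵐ y ∂ν, MemLp (fun x => Φ (x, y)) 2 μ := by
  have h := ((memLp_two_iff_integrable_sq_norm (Lp.aestronglyMeasurable Φ)).1
    (Lp.memLp Φ)).prod_left_ae
  filter_upwards [h] with y hy
  refine (memLp_two_iff_integrable_sq_norm ?_).2 hy
  exact ((Lp.stronglyMeasurable Φ).comp_measurable measurable_prodMk_right).aestronglyMeasurable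

/-- The adjoint of `b ↦ a ⊗ b` is the partial inner product with `a`. -/
lemma adjoint_tensorLeft_ae [SigmaFinite ν] (a : Lp ℂ 2 μ) (ha : ‖a‖ = 1)
    (Φ : Lp ℂ 2 (μ.prod ν)) :
    ContinuousLinearMap.adjoint (tensorLeft ν a ha).toContinuousLinearMap Φ =ᵐ[ν]
      fun y => ∫ x, inner ℂ (a x) (Φ (x, y)) ∂μ := by
  set c := ContinuousLinearMap.adjoint (tensorLeft ν a ha).toContinuousLinearMap Φ with hc
  -- Testing the adjoint against the indicator of `s` gives `⟨a ⊗ 1_s, Φ⟩`, which Fubini evaluates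
  -- as the integral over `s` of the partial inner product.
  have key : ∀ s, MeasurableSet s → ν s < ⊤ →
      IntegrableOn (fun y => ∫ x, inner ℂ (a x) (Φ (x, y)) ∂μ) s ν ∧
      ∫ y in s, c y ∂ν = ∫ y in s, ∫ x, inner ℂ (a x) (Φ (x, y)) ∂μ ∂ν := by
    intro s hs hνs
    set b : Lp ℂ 2 ν := indicatorConstLp 2 hs hνs.ne 1 with hb
    have hint : Integrable (fun p : X × Y =>
        s.indicator (fun _ => inner ℂ (a p.1) (Φ p)) p.2) (μ.prod ν) := by
      refine (L2.integrable_inner (𝕜 := ℂ) (tensor a b) Φ).congr ?_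
      filter_upwards [tensor_ae a b, Measure.quasiMeasurePreserving_snd.ae
        (indicatorConstLp_coeFn (p := 2) (hs := hs) (hμs := hνs.ne) (c := (1 : ℂ)))] with p h1 h2
      rw [h1, h2]
      by_cases hp : p.2 ∈ s <;> simp [hp]
    have hsec : ∀ y, ∫ x, s.indicator (fun _ => inner ℂ (a x) (Φ (x, y))) y ∂μ =
        s.indicator (fun y => ∫ x, inner ℂ (a x) (Φ (x, y)) ∂μ) y := by
      intro y
      by_cases hy : y ∈ s <;> simp [hy]
    constructor
    · have h := hint.integral_prod_right
      simp only [hsec] at h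
      exact (integrable_indicator_iff hs).1 h
    · have h1 : inner ℂ b c = inner ℂ (tensor a b) Φ := by
        rw [hc, ContinuousLinearMap.adjoint_inner_right]
        rfl
      rw [hb, L2.inner_indicatorConstLp_one, ← hb] at h1
      rw [h1, L2.inner_def, ← integral_indicator hs]
      simp only [← hsec]
      rw [← integral_prod_symm (f := fun p : X × Y =>
        s.indicator (fun _ => inner ℂ (a p.1) (Φ p)) p.2) hint]
      refine integral_congr_ae ?_
      filter_upwards [tensor_ae a b, Measure.quasiMeasurePreserving_snd.ae
        (indicatorConstLp_coeFn (p := 2) (hs := hs) (hμs := hνs.ne) (c := (1 : ℂ)))] with p h1 h2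
      rw [h1, h2]
      by_cases hp : p.2 ∈ s <;> simp [hp]
  refine ae_eq_of_forall_setIntegral_eq_of_sigmaFinite ?_ (fun s hs h => (key s hs h).1)
    (fun s hs h => (key s hs h).2)
  intro s hs hνs
  exact integrableOn_Lp_of_measure_ne_top c (by norm_num) hνs.ne

/-- The partial inner product with `a` is the inner product with the sections. -/
lemma adjoint_tensorLeft_section [SigmaFinite ν] (a : Lp ℂ 2 μ) (ha : ‖a‖ = 1)
    (Φ : Lp ℂ 2 (μ.prod ν)) :
    ∀ᵐ y ∂ν, ∀ φ : Lp ℂ 2 μ, φ =ᵐ[μ] (fun x => Φ (x, y)) →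
      inner ℂ a φ = ContinuousLinearMap.adjoint (tensorLeft ν a ha).toContinuousLinearMap Φ y := by
  -- The null set depends on `a` and `Φ` only; `φ` is chosen after `y`.
  filter_upwards [adjoint_tensorLeft_ae a ha Φ] with y hy φ hφ
  rw [hy, L2.inner_def]
  refine integral_congr_ae ?_
  filter_upwards [hφ] with x hx
  rw [hx]

/-- Two square integrable functions on a product are equal if their partial inner products with an
orthonormal basis are. -/
lemma ext_tensorLeft [SigmaFinite ν] {J : Type*} [Countable J] (η : HilbertBasis J ℂ (Lp ℂ 2 μ))
    {Φ : Lp ℂ 2 (μ.prod ν)}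
    (h : ∀ j b, inner ℂ (tensor (η j) b) Φ = 0) : Φ = 0 := by
  have h0 : ∀ j, ContinuousLinearMap.adjoint
      (tensorLeft ν (η j) (η.orthonormal.1 j)).toContinuousLinearMap Φ = 0 := by
    intro j
    refine ext_inner_left ℂ fun b => ?_
    rw [ContinuousLinearMap.adjoint_inner_right, inner_zero_right]
    exact h j b
  -- Outside one null set, by countability of `J`, the section at `y` is orthogonal to every `η j`,
  -- hence zero.
  have hz : ∀ᵐ y ∂ν, ∀ᵐ x ∂μ, Φ (x, y) = 0 := by
    filter_upwards [memLp_section Φ,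
      ae_all_iff.2 fun j => adjoint_tensorLeft_section (η j) (η.orthonormal.1 j) Φ,
      Lp.coeFn_zero ℂ 2 ν] with y hy hj h00
    have h1 : hy.toLp _ = 0 := by
      refine HilbertBasis.ext_inner η fun j => ?_
      rw [hj j _ hy.coeFn_toLp, h0 j, h00, inner_zero_right]
      rfl
    filter_upwards [hy.coeFn_toLp, (Lp.eq_zero_iff_ae_eq_zero.1 h1)] with x h2 h3
    rw [← h2, h3]
    rfl
  refine Lp.eq_zero_iff_ae_eq_zero.2 ?_
  have hm : MeasurableSet {p : Y × X | Φ p.swap = 0} :=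
    ((Lp.stronglyMeasurable Φ).measurable.comp measurable_swap) (measurableSet_singleton 0)
  have h2 := (Measure.ae_prod_iff_ae_ae hm).2 hz
  have h3 : ∀ᵐ p ∂μ.prod ν, Φ p.swap.swap = 0 :=
    (Measure.measurePreserving_swap (μ := μ) (ν := ν)).quasiMeasurePreserving.ae h2
  exact h3

/-- Orthogonality is inherited from `η` through `inner_tensor`. The span is dense because its
orthogonal complement vanishes by `ext_tensorLeft`. -/
lemma isHilbertSum_tensorLeft [SigmaFinite ν] {J : Type*} [Countable J]
    (η : HilbertBasis J ℂ (Lp ℂ 2 μ)) :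
    IsHilbertSum ℂ (fun _ : J => Lp ℂ 2 ν)
      (fun j => tensorLeft ν (η j) (η.orthonormal.1 j)) := by
  refine IsHilbertSum.mk ?_ (top_le_iff.2 ?_)
  · intro i j hij b c
    change inner ℂ (tensor (η i) b) (tensor (η j) c) = 0
    rw [inner_tensor, η.orthonormal.2 hij, zero_mul]
  · rw [Submodule.topologicalClosure_eq_top_iff, Submodule.eq_bot_iff]
    intro Φ hΦ
    refine ext_tensorLeft η fun j b => ?_
    exact (Submodule.mem_orthogonal _ _).1 hΦ _ (Submodule.mem_iSup_of_mem j ⟨b, rfl⟩)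

/-- A unitary operator `T` of `L²(X)` acts unitarily on the sections of the square integrable
functions on `X × Y`. -/
lemma exists_section_isometry [SigmaFinite ν] [TopologicalSpace.SeparableSpace (Lp ℂ 2 μ)]
    (T : Lp ℂ 2 μ ≃ₗᵢ[ℂ] Lp ℂ 2 μ) :
    ∃ V : Lp ℂ 2 (μ.prod ν) ≃ₗᵢ[ℂ] Lp ℂ 2 (μ.prod ν), ∀ Φ, ∀ᵐ y ∂ν, ∀ φ : Lp ℂ 2 μ,
      φ =ᵐ[μ] (fun x => Φ (x, y)) → T φ =ᵐ[μ] fun x => V Φ (x, y) := by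
  obtain ⟨w, η, -⟩ := exists_hilbertBasis ℂ (Lp ℂ 2 μ)
  have hJ : Countable w := countable_of_orthonormal η.orthonormal
  let η' := HilbertBasis.mapIsometry η T
  have h1 := isHilbertSum_tensorLeft (ν := ν) η
  have h2 := isHilbertSum_tensorLeft (ν := ν) η'
  -- `V` is `T ⊗ 1`: it sends `η_j ⊗ b` to `T η_j ⊗ b`.
  let V := IsHilbertSum.equiv h1 h2
  have hV : ∀ j b, V (tensor (η j) b) = tensor (η' j) b := fun j b =>
    IsHilbertSum.equiv_apply h1 h2 j b
  have hadj : ∀ j Φ, ContinuousLinearMap.adjoint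
        (tensorLeft ν (η' j) (η'.orthonormal.1 j)).toContinuousLinearMap (V Φ) =
      ContinuousLinearMap.adjoint
        (tensorLeft ν (η j) (η.orthonormal.1 j)).toContinuousLinearMap Φ := by
    intro j Φ
    refine ext_inner_left ℂ fun b => ?_
    rw [ContinuousLinearMap.adjoint_inner_right, ContinuousLinearMap.adjoint_inner_right]
    change inner ℂ (tensor (η' j) b) (V Φ) = inner ℂ (tensor (η j) b) Φ
    rw [← hV, V.inner_map_map]
  refine ⟨V, fun Φ => ?_⟩
  filter_upwards [memLp_section (V Φ),
    ae_all_iff.2 fun j => adjoint_tensorLeft_section (η j) (η.orthonormal.1 j) Φ,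
    ae_all_iff.2 fun j => adjoint_tensorLeft_section (η' j) (η'.orthonormal.1 j) (V Φ)]
    with y hy hj hj' φ hφ
  -- The section of `V Φ` has the same coefficients in the basis `T η_j` as the section `φ` of `Φ`
  -- has in the basis `η_j`, and so has `T φ`.
  have h3 : T φ = hy.toLp _ := by
    refine HilbertBasis.ext_inner η' fun j => ?_
    rw [hj' j _ hy.coeFn_toLp, hadj, ← hj j φ hφ, HilbertBasis.mapIsometry_apply, T.inner_map_map]
  rw [h3]
  exact hy.coeFn_toLp

end Tensor

/-! ### The Fourier transform of square integrable functions -/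

open FourierTransform in
/-- On integrable functions the unitary Fourier transform is given by the Fourier integral. -/
lemma fourierTransform_ae_of_integrable {E : Type*} [NormedAddCommGroup E] [MeasurableSpace E]
    [BorelSpace E] [InnerProductSpace ℝ E] [FiniteDimensional ℝ E]
    (φ : Lp ℂ 2 (volume : Measure E)) (hφ : Integrable φ) :
    Lp.fourierTransformₗᵢ E ℂ φ =ᵐ[volume] 𝓕 (φ : E → ℂ) := by
  have hcont : Continuous (𝓕 (φ : E → ℂ)) :=
    VectorFourier.fourierIntegral_continuous Real.continuous_fourierChar
      (by exact continuous_inner) hφ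
  -- Both sides are tested against smooth compactly supported `g`. The unitary transform agrees with
  -- that of tempered distributions, and the Fourier integral satisfies the same duality formula, so
  -- both pairings equal `∫ 𝓕 g · φ`.
  refine ae_eq_of_integral_contDiff_smul_eq
    ((Lp.memLp _).locallyIntegrable (by norm_num)) hcont.locallyIntegrable fun g hg hgc => ?_
  have hg₁ : HasCompactSupport (Complex.ofRealCLM ∘ g) := hgc.comp_left rfl
  have hg₂ : ContDiff ℝ (⊤ : ℕ∞) (Complex.ofRealCLM ∘ g) := by fun_prop
  set G : SchwartzMap E ℂ := hg₁.toSchwartzMap hg₂ with hG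
  have hGg : ∀ x, G x = (g x : ℂ) := fun x => rfl
  have h1 := congrArg (fun S : TemperedDistribution E ℂ => S G)
    (Lp.fourier_toTemperedDistribution_eq φ)
  simp only [TemperedDistribution.fourier_apply, Lp.toTemperedDistribution_apply] at h1
  have h2 := VectorFourier.integral_fourierIntegral_smul_eq_flip (μ := (volume : Measure E))
    (ν := (volume : Measure E)) (f := G) (g := (φ : E → ℂ)) (L := innerₗ E)
    Real.continuous_fourierChar (by exact continuous_inner) G.integrable hφ
  rw [flip_innerₗ] at h2
  have h3 : ∀ f : E → ℂ, ∫ x, g x • f x = ∫ x, G x • f x := by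
    intro f
    refine integral_congr_ae (Filter.Eventually.of_forall fun x => ?_)
    simp [hGg]
  rw [h3, h3]
  exact h1.symm.trans h2

lemma e_eq_fourierChar (t : ℝ) : e t = (Real.fourierChar t : ℂ) := by
  rw [Real.fourierChar_apply, e]

lemma rowCol_eq_inner {n : ℕ} (ω x : Vec n) : rowCol ω x = inner ℝ ω x := by
  simp [rowCol, dotProduct, PiLp.inner_apply, mul_comm]

open FourierTransform in
lemma fourier_eq_integral_e {n : ℕ} (φ : Vec n → ℂ) (z : Vec n) :
    𝓕 φ z = ∫ ω, φ ω * e (-rowCol ω z) := by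
  rw [Real.fourier_eq]
  refine integral_congr_ae (Filter.Eventually.of_forall fun ω => ?_)
  simp only [rowCol_eq_inner, e_eq_fourierChar, Circle.smul_def, smul_eq_mul]
  exact mul_comm _ _

lemma continuous_e_rowCol {n : ℕ} (u : Vec n) : Continuous fun ω : Vec n => e (rowCol ω u) := by
  refine continuous_e.comp ?_
  simp only [rowCol_eq_inner]
  fun_prop

open FourierTransform in
/-- The Fourier transform turns modulations into translations. -/
lemma fourierTransform_mulUnimodular {n : ℕ} (u : Vec n) (φ : L2Vec n) :
    Lp.fourierTransformₗᵢ (Vec n) ℂ (mulUnimodular volume (fun ω => e (rowCol ω u))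
      (continuous_e_rowCol u).measurable (fun _ => norm_e _) φ) =
    Lp.compMeasurePreservingₗᵢ ℂ (fun z => z - u) (measurePreserving_sub_right volume u)
      (Lp.fourierTransformₗᵢ (Vec n) ℂ φ) := by
  -- Both sides are continuous in `φ`, so Schwartz functions suffice; there the transform is an
  -- integral and `e(ω u) e(-ω z) = e(-ω (z - u))`.
  refine DenseRange.induction_on (SchwartzMap.denseRange_toLpCLM (E := Vec n) (F := ℂ) (p := 2)
    (μ := volume) ENNReal.ofNat_ne_top) φ ?_ ?_
  · exact isClosed_eq
      ((LinearIsometryEquiv.continuous _).comp (LinearIsometry.continuous _))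
      ((LinearIsometry.continuous _).comp (LinearIsometryEquiv.continuous _))
  · intro g
    set ψ : L2Vec n := SchwartzMap.toLpCLM ℝ ℂ 2 volume g with hψ
    have hψg : ψ =ᵐ[volume] g := SchwartzMap.coeFn_toLp g 2 volume
    have hint : Integrable ψ := g.integrable.congr hψg.symm
    set χ := mulUnimodular volume (fun ω : Vec n => e (rowCol ω u))
      (continuous_e_rowCol u).measurable (fun _ => norm_e _) ψ with hχ
    have hχψ : χ =ᵐ[volume] fun ω => e (rowCol ω u) * ψ ω :=
      MemLp.coeFn_toLp (memLp_mul (continuous_e_rowCol u).measurable (fun _ => norm_e _) ψ)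
    have hint' : Integrable χ := by
      refine (hint.mono ?_ ?_ : Integrable (fun ω => e (rowCol ω u) * ψ ω) volume).congr hχψ.symm
      · exact (continuous_e_rowCol u).aestronglyMeasurable.mul (Lp.aestronglyMeasurable ψ)
      · exact Filter.Eventually.of_forall fun ω => by rw [norm_mul, norm_e, one_mul]
    refine Lp.ext ?_
    refine (fourierTransform_ae_of_integrable χ hint').trans ?_
    refine Filter.EventuallyEq.trans ?_
      (Lp.coeFn_compMeasurePreserving _ (measurePreserving_sub_right volume u)).symm
    filter_upwards [(measurePreserving_sub_right (volume : Measure (Vec n)) u).quasiMeasurePreserving.ae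
      (fourierTransform_ae_of_integrable ψ hint)] with z hz
    rw [Function.comp_apply, hz, fourier_eq_integral_e, fourier_eq_integral_e]
    refine integral_congr_ae ?_
    filter_upwards [hχψ] with ω hω
    rw [hω, mul_comm (e _), mul_assoc, ← e_add, rowCol_eq_inner, rowCol_eq_inner, rowCol_eq_inner,
      inner_sub_right]
    congr 2
    ring

/-! ### Invariance of the measures -/

/-- Right multiplication by `A`, on arrays of matrix entries. -/
def entriesMul {n : ℕ} (A : GL (Fin n) ℝ) (M : Fin n → Fin n → ℝ) : Fin n → Fin n → ℝ :=
  fun i => Matrix.toLin' A.val.transpose (M i)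

lemma entries_mul_right {n : ℕ} (B A : GL (Fin n) ℝ) :
    entries n (B * A) = entriesMul A (entries n B) := by
  ext i j
  simp [entries, entriesMul, Matrix.mul_apply, Matrix.mulVec, dotProduct, mul_comm]

lemma measurable_entriesMul {n : ℕ} (A : GL (Fin n) ℝ) : Measurable (entriesMul A) :=
  measurable_pi_lambda _ fun i =>
    (LinearMap.continuous_of_finiteDimensional _).measurable.comp (measurable_pi_apply i)

/-- Right multiplication acts on each of the `n` rows by the transpose of `A`, and every row
contributes a factor `|det A|⁻¹`. -/
lemma map_entriesMul_volume {n : ℕ} (A : GL (Fin n) ℝ) :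
    (volume : Measure (Fin n → Fin n → ℝ)).map (entriesMul A) = (absDet A ^ n)⁻¹ • volume := by
  have hdet : A.val.transpose.det ≠ 0 := by
    rw [Matrix.det_transpose]
    exact det_ne_zero A
  have hA : (volume : Measure (Fin n → ℝ)).map (Matrix.toLin' A.val.transpose) =
      (absDet A)⁻¹ • volume := by
    rw [Real.map_matrix_volume_pi_eq_smul_volume_pi hdet, abs_inv,
      ENNReal.ofReal_inv_of_pos (abs_pos.2 hdet), Matrix.det_transpose]
    rfl
  have hmA : Measurable (Matrix.toLin' A.val.transpose) :=
    (LinearMap.continuous_of_finiteDimensional _).measurable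
  have hsf : SigmaFinite ((volume : Measure (Fin n → ℝ)).map (Matrix.toLin' A.val.transpose)) := by
    rw [hA]
    obtain ⟨c, hc⟩ := WithTop.ne_top_iff_exists.1 (ENNReal.inv_ne_top.2 (absDet_ne_zero A))
    rw [← hc]
    exact inferInstanceAs (SigmaFinite (c • (volume : Measure (Fin n → ℝ))))
  have h := Measure.pi_map_pi (ι := Fin n) (μ := fun _ => (volume : Measure (Fin n → ℝ)))
    (f := fun _ => Matrix.toLin' A.val.transpose) (hμ := fun _ => hsf) fun _ => hmA.aemeasurable
  refine h.trans (Measure.pi_eq fun s hs => ?_)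
  rw [hA]
  simp only [Measure.smul_apply, smul_eq_mul]
  rw [Finset.prod_mul_distrib, Finset.prod_const, Finset.card_univ, Fintype.card_fin,
    ENNReal.inv_pow, volume_pi_pi]

/-- The scaling factor is the same as for left multiplication, so the density `|det|⁻ⁿ` compensates
on both sides. -/
lemma map_mul_right_lebesgueGL {n : ℕ} (A : GL (Fin n) ℝ) :
    (lebesgueGL n).map (· * A) = (absDet A ^ n)⁻¹ • lebesgueGL n := by
  have hm : Measurable (fun B : GL (Fin n) ℝ => B * A) := (continuous_mul_const A).measurable
  have he := measurableEmbedding_entries n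
  have hinv : ∀ M : Fin n → Fin n → ℝ, entriesMul A⁻¹ (entriesMul A M) = M := by
    intro M
    funext i
    simp only [entriesMul, Matrix.toLin'_apply, Matrix.mulVec_mulVec]
    rw [← Matrix.transpose_mul, ← Units.val_mul, mul_inv_cancel, Units.val_one,
      Matrix.transpose_one, Matrix.one_mulVec]
  ext s hs
  rw [Measure.map_apply hm hs, Measure.smul_apply, lebesgueGL, he.comap_apply, he.comap_apply,
    ← Measure.smul_apply, ← map_entriesMul_volume,
    Measure.map_apply (measurable_entriesMul A) (he.measurableSet_image.2 hs)]
  congr 1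
  ext M
  constructor
  · rintro ⟨B, hB, rfl⟩
    exact ⟨B * A, hB, entries_mul_right B A⟩
  · rintro ⟨B, hB, h⟩
    refine ⟨B * A⁻¹, by simpa using hB, ?_⟩
    rw [entries_mul_right, h, hinv]

/-- `GL_n(ℝ)` is unimodular. -/
instance instIsMulRightInvariantHaarGL (n : ℕ) : (haarGL n).IsMulRightInvariant where
  map_mul_right_eq_self A := by
    refine map_withDensity_eq _ (continuous_mul_const A).measurable
      ((measurable_absDet n).pow_const n).inv (pow_ne_zero n (absDet_ne_zero A))
      (ENNReal.pow_ne_top (absDet_ne_top A)) (map_mul_right_lebesgueGL A) fun B => ?_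
    rw [absDet_mul, mul_comm (absDet B), mul_pow,
      ENNReal.mul_inv (Or.inl (pow_ne_zero n (absDet_ne_zero A)))
      (Or.inl (ENNReal.pow_ne_top (absDet_ne_top A))), ← mul_assoc,
      ENNReal.mul_inv_cancel (pow_ne_zero n (absDet_ne_zero A))
      (ENNReal.pow_ne_top (absDet_ne_top A)), one_mul]

/-- The map `(ω, B) ↦ (ω, B δ(ω))`. -/
def shear {n : ℕ} (δ : Vec n → GL (Fin n) ℝ) (p : Vec n × GL (Fin n) ℝ) : Vec n × GL (Fin n) ℝ :=
  (p.1, p.2 * δ p.1)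

/-- For fixed `ω` the shear is a right translation, under which `haarGL` is invariant. -/
lemma measurePreserving_shear {n : ℕ} {δ : Vec n → GL (Fin n) ℝ} (hδ : Measurable δ) :
    MeasurePreserving (shear δ) ((volume : Measure (Vec n)).prod (haarGL n))
      ((volume : Measure (Vec n)).prod (haarGL n)) := by
  refine (MeasurePreserving.id _).skew_product (g := fun ω B => B * δ ω) ?_ ?_
  · exact measurable_snd.mul (hδ.comp measurable_fst)
  · exact Filter.Eventually.of_forall fun ω => map_mul_right_eq_self _ _

/-- The map `[y, B] ↦ (B⁻¹ y, B)`. -/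
def untwist {n : ℕ} (g : Aff n) : Vec n × GL (Fin n) ℝ := (mulCol g.lin⁻¹ g.vec, g.lin)

/-- The map `(z, B) ↦ [B z, B]`. -/
def twist {n : ℕ} (p : Vec n × GL (Fin n) ℝ) : Aff n := ⟨mulCol p.2 p.1, p.2⟩

lemma twist_untwist {n : ℕ} (g : Aff n) : twist (untwist g) = g := by
  ext1
  · exact mulCol_mulCol_inv _ _
  · rfl

lemma measurable_untwist (n : ℕ) : Measurable (untwist (n := n)) :=
  ((continuous_mulCol_uncurry (continuous_lin n).inv (continuous_vec n)).prodMk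
    (continuous_lin n)).measurable

lemma measurable_twist (n : ℕ) : Measurable (twist (n := n)) :=
  ((Aff.homeoProd n).symm.continuous.comp
    ((continuous_mulCol_uncurry continuous_snd continuous_fst).prodMk continuous_snd)).measurable

lemma map_mulCol_volume {n : ℕ} (A : GL (Fin n) ℝ) :
    (volume : Measure (Vec n)).map (mulCol A) = (absDet A)⁻¹ • volume := by
  simpa using map_affine_volume 0 A

lemma quasiMeasurePreserving_mulCol {n : ℕ} (A : GL (Fin n) ℝ) :
    Measure.QuasiMeasurePreserving (mulCol A) (volume : Measure (Vec n)) volume := by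
  refine ⟨(continuous_mulCol A).measurable, ?_⟩
  rw [map_mulCol_volume]
  exact Measure.smul_absolutelyContinuous

/-- On the fibre over `B`, the map `y ↦ B⁻¹ y` pushes Lebesgue measure to `|det B|` times itself,
which cancels the density `|det B|⁻¹`. -/
lemma measurePreserving_untwist (n : ℕ) :
    MeasurePreserving (untwist (n := n)) (haarAff n)
      ((volume : Measure (Vec n)).prod (haarGL n)) := by
  refine ⟨measurable_untwist n, ?_⟩
  have hs : Measurable (Aff.equivProd n).symm := (Aff.measurableEquivProd n).symm.measurable
  have hu : Measurable (untwist ∘ (Aff.equivProd n).symm) := (measurable_untwist n).comp hs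
  have hd : Measurable fun p : Vec n × GL (Fin n) ℝ => (absDet p.2)⁻¹ :=
    ((measurable_absDet n).comp measurable_snd).inv
  rw [haarAff, Measure.map_map (measurable_untwist n) hs]
  ext s hsm
  rw [Measure.map_apply hu hsm, withDensity_apply _ (hu hsm), ← lintegral_indicator (hu hsm),
    lintegral_prod_symm _ ((hd.indicator (hu hsm)).aemeasurable), Measure.prod_apply_symm hsm]
  refine lintegral_congr fun B => ?_
  have hsec : MeasurableSet ((fun z : Vec n => (z, B)) ⁻¹' s) := measurable_prodMk_right hsm
  have h1 : ∀ y : Vec n, (untwist ∘ (Aff.equivProd n).symm ⁻¹' s).indicator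
      (fun p : Vec n × GL (Fin n) ℝ => (absDet p.2)⁻¹) (y, B) =
      (mulCol B⁻¹ ⁻¹' ((fun z : Vec n => (z, B)) ⁻¹' s)).indicator
        (fun _ => (absDet B)⁻¹) y := fun y => rfl
  simp only [h1]
  rw [lintegral_indicator ((continuous_mulCol B⁻¹).measurable hsec), setLIntegral_const,
    ← Measure.map_apply (continuous_mulCol B⁻¹).measurable hsec, map_mulCol_volume,
    Measure.smul_apply, smul_eq_mul, ← mul_assoc,
    ← ENNReal.mul_inv (Or.inl (absDet_ne_zero _)) (Or.inl (absDet_ne_top _)), ← absDet_mul,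
    mul_inv_cancel]
  simp [absDet]

lemma measurePreserving_twist (n : ℕ) :
    MeasurePreserving (twist (n := n)) ((volume : Measure (Vec n)).prod (haarGL n))
      (haarAff n) := by
  refine ⟨measurable_twist n, ?_⟩
  rw [← (measurePreserving_untwist n).map_eq,
    Measure.map_map (measurable_twist n) (measurable_untwist n)]
  have h : twist ∘ untwist = (id : Aff n → Aff n) := funext twist_untwist
  rw [h, Measure.map_id]

/-- Composition with a bijection that preserves the measures, as a unitary operator of `L²`. -/
def compMeasurePreservingEquiv {α β : Type*} [MeasurableSpace α] [MeasurableSpace β]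
    {μ : Measure α} {ν : Measure β} {f : α → β} {g : β → α} (hf : MeasurePreserving f μ ν)
    (hg : MeasurePreserving g ν μ) (hfg : ∀ a, g (f a) = a) : Lp ℂ 2 ν ≃ₗᵢ[ℂ] Lp ℂ 2 μ :=
  LinearIsometryEquiv.ofSurjective (Lp.compMeasurePreservingₗᵢ ℂ f hf) fun h =>
    ⟨Lp.compMeasurePreservingₗᵢ ℂ g hg h, by
      refine Lp.ext ((Lp.coeFn_compMeasurePreserving _ hf).trans ?_)
      filter_upwards [hf.quasiMeasurePreserving.ae (Lp.coeFn_compMeasurePreserving h hg)] with a ha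
      rw [Function.comp_apply]
      exact ha.trans (congrArg h (hfg a))⟩

lemma compMeasurePreservingEquiv_ae {α β : Type*} [MeasurableSpace α] [MeasurableSpace β]
    {μ : Measure α} {ν : Measure β} {f : α → β} {g : β → α} (hf : MeasurePreserving f μ ν)
    (hg : MeasurePreserving g ν μ) (hfg : ∀ a, g (f a) = a) (h : Lp ℂ 2 ν) :
    compMeasurePreservingEquiv hf hg hfg h =ᵐ[μ] fun a => h (f a) :=
  Lp.coeFn_compMeasurePreserving h hf

/-! ### Functions on the orbit -/

/-- The extension by the identity matrix of a map on the orbit. -/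
def extendOrbit {n : ℕ} (γ : orbit n → GL (Fin n) ℝ) (ω : Vec n) : GL (Fin n) ℝ :=
  open Classical in if h : ω ∈ orbit n then γ ⟨ω, h⟩ else 1

lemma extendOrbit_coe {n : ℕ} (γ : orbit n → GL (Fin n) ℝ) (ω : orbit n) :
    extendOrbit γ ω = γ ω := dif_pos ω.2

lemma measurableSet_orbit (n : ℕ) : MeasurableSet (orbit n) :=
  (measurableSet_singleton (0 : Vec n)).compl

lemma measurable_extendOrbit {n : ℕ} {γ : orbit n → GL (Fin n) ℝ} (hγ : Measurable γ) :
    Measurable (extendOrbit γ) := by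
  classical
  exact Measurable.dite (s := orbit n) (f := γ) (g := fun _ => 1) hγ measurable_const
    (measurableSet_orbit n)

/-- This needs `n ≥ 1`: in dimension zero the origin is the whole space. -/
lemma ae_mem_orbit (n : ℕ) [NeZero n] : ∀ᵐ ω : Vec n, ω ∈ orbit n :=
  Measure.ae_ne volume 0

lemma map_coe_volumeOrbit (n : ℕ) [NeZero n] : (volumeOrbit n).map Subtype.val = volume := by
  rw [volumeOrbit, map_comap_subtype_coe (measurableSet_orbit n),
    Measure.restrict_eq_self_of_ae_mem (ae_mem_orbit n)]

lemma measurePreserving_coe_orbit (n : ℕ) [NeZero n] :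
    MeasurePreserving (Subtype.val : orbit n → Vec n) (volumeOrbit n) volume :=
  ⟨measurable_subtype_coe, map_coe_volumeOrbit n⟩

lemma ae_volumeOrbit_iff {n : ℕ} [NeZero n] {p : Vec n → Prop} :
    (∀ᵐ ω : orbit n ∂volumeOrbit n, p ω) ↔ ∀ᵐ ω : Vec n, p ω := by
  rw [← map_coe_volumeOrbit n,
    (MeasurableEmbedding.subtype_coe (measurableSet_orbit n)).ae_map_iff]

/-! ### Partial Fourier integrals -/

lemma ae_ae_snd_of_ae_prod {X Y : Type*} [MeasurableSpace X] [MeasurableSpace Y] {μ : Measure X}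
    {ν : Measure Y} [SFinite μ] [SFinite ν] {p : X × Y → Prop} (h : ∀ᵐ a ∂μ.prod ν, p a) :
    ∀ᵐ y ∂ν, ∀ᵐ x ∂μ, p (x, y) :=
  Measure.ae_ae_of_ae_prod
    ((Measure.measurePreserving_swap (μ := ν) (ν := μ)).quasiMeasurePreserving.ae h)

lemma ae_ae_of_ae_haarAff {n : ℕ} {p : Aff n → Prop} (h : ∀ᵐ g ∂haarAff n, p g) :
    ∀ᵐ B ∂haarGL n, ∀ᵐ y : Vec n, p ⟨y, B⟩ := by
  filter_upwards [ae_ae_snd_of_ae_prod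
    ((measurePreserving_twist n).quasiMeasurePreserving.ae h)] with B hB
  filter_upwards [(quasiMeasurePreserving_mulCol B⁻¹).ae hB] with y hy
  simpa only [twist, mulCol_mulCol_inv] using hy

/-- A converse of Fubini for null sets, hence the measurability assumption. The coordinates `y` and
`B⁻¹ y` on a fibre have the same null sets. -/
lemma ae_haarAff_of_ae_ae {n : ℕ} {p : Aff n → Prop} (hp : MeasurableSet {g | p g})
    (h : ∀ᵐ B ∂haarGL n, ∀ᵐ y : Vec n, p ⟨y, B⟩) : ∀ᵐ g ∂haarAff n, p g := by
  have h1 : ∀ᵐ B ∂haarGL n, ∀ᵐ z : Vec n, p (twist (z, B)) := by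
    filter_upwards [h] with B hB
    exact (quasiMeasurePreserving_mulCol B).ae hB
  have hm : MeasurableSet {q : GL (Fin n) ℝ × Vec n | p (twist q.swap)} :=
    ((measurable_twist n).comp measurable_swap) hp
  have h2 := (Measure.measurePreserving_swap (μ := (volume : Measure (Vec n)))
    (ν := haarGL n)).quasiMeasurePreserving.ae ((Measure.ae_prod_iff_ae_ae hm).2 h1)
  filter_upwards [(measurePreserving_untwist n).quasiMeasurePreserving.ae h2] with g hg
  simpa only [Prod.swap_swap, twist_untwist] using hg

instance instSeparableSpaceL2Vec (n : ℕ) : TopologicalSpace.SeparableSpace (L2Vec n) := by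
  have : Fact ((2 : ENNReal) ≠ ⊤) := ⟨ENNReal.ofNat_ne_top⟩
  infer_instance

/-- The tensor products `η ⊗ f` are carried by one unitary operator to the partial Fourier
integrals. -/
lemma exists_isometry_isPartialFourierIntegral {n : ℕ} [NeZero n] {γ : orbit n → GL (Fin n) ℝ}
    (hγ : Measurable γ) :
    ∃ W : Lp ℂ 2 ((volume : Measure (Vec n)).prod (haarGL n)) ≃ₗᵢ[ℂ] L2Aff n,
      ∀ (η : L2Vec n) (f : L2GL n), IsPartialFourierIntegral γ η f (W (tensor η f)) := by
  have hδ := measurable_extendOrbit hγ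
  let S := compMeasurePreservingEquiv (measurePreserving_shear hδ)
    (measurePreserving_shear hδ.inv) (fun p => by simp [shear])
  obtain ⟨V, hV⟩ := exists_section_isometry (ν := haarGL n) (Lp.fourierTransformₗᵢ (Vec n) ℂ)
  let K := compMeasurePreservingEquiv (measurePreserving_untwist n) (measurePreserving_twist n)
    twist_untwist
  -- `S` composes with the shear, `V` is the Fourier transform in the first variable, and `K` passes
  -- to the coordinates `[y, B]`.
  refine ⟨(S.trans V).trans K, fun η f => ?_⟩
  set Φ := S (tensor η f) with hΦ
  have h1 : ∀ᵐ p ∂(volume : Measure (Vec n)).prod (haarGL n),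
      Φ p = η p.1 * f (p.2 * extendOrbit γ p.1) := by
    filter_upwards [compMeasurePreservingEquiv_ae (measurePreserving_shear hδ)
      (measurePreserving_shear hδ.inv) (fun p => by simp [shear]) (tensor η f),
      (measurePreserving_shear hδ).quasiMeasurePreserving.ae (tensor_ae η f)] with p ha hb
    exact ha.trans hb
  filter_upwards [ae_ae_snd_of_ae_prod h1, memLp_section Φ, hV Φ,
    ae_ae_of_ae_haarAff (compMeasurePreservingEquiv_ae (measurePreserving_untwist n)
      (measurePreserving_twist n) twist_untwist (V Φ))] with B hB1 hB2 hB3 hB4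
  refine ⟨hB2.toLp _, ?_, ?_⟩
  · have h2 : ∀ᵐ ω : Vec n, hB2.toLp _ ω = η ω * f (B * extendOrbit γ ω) := by
      filter_upwards [hB1, hB2.coeFn_toLp] with ω ha hb
      rw [hb, ha]
    filter_upwards [ae_volumeOrbit_iff.2 h2] with ω hω
    rw [hω, extendOrbit_coe]
  · filter_upwards [hB4, (quasiMeasurePreserving_mulCol B⁻¹).ae (hB3 _ hB2.coeFn_toLp)] with y ha hb
    exact ha.trans hb.symm

/-- The orbit is conull, so `φ` is determined for almost every `B`, and with it almost every fibre
of `h`. -/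
lemma IsPartialFourierIntegral.unique {n : ℕ} [NeZero n] {γ : orbit n → GL (Fin n) ℝ}
    {η : L2Vec n} {f : L2GL n} {h h' : L2Aff n} (H : IsPartialFourierIntegral γ η f h)
    (H' : IsPartialFourierIntegral γ η f h') : h = h' := by
  refine Lp.ext (ae_haarAff_of_ae_ae ?_ ?_)
  · exact measurableSet_eq_fun (Lp.stronglyMeasurable h).measurable
      (Lp.stronglyMeasurable h').measurable
  · filter_upwards [H, H'] with B ⟨φ, hφ, hy⟩ ⟨φ', hφ', hy'⟩
    have hφφ' : φ = φ' := by
      refine Lp.ext (ae_volumeOrbit_iff.1 ?_)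
      filter_upwards [hφ, hφ'] with ω ha hb
      rw [ha, hb]
    filter_upwards [hy, hy'] with y ha hb
    rw [ha, hb, hφφ']

instance instSigmaFiniteVolumeOrbit (n : ℕ) [NeZero n] : SigmaFinite (volumeOrbit n) :=
  .of_map _ measurable_subtype_coe.aemeasurable (by rw [map_coe_volumeOrbit]; infer_instance)

lemma stronglyMeasurable_integrand {n : ℕ} {γ : orbit n → GL (Fin n) ℝ} (hγ : Measurable γ)
    (η : L2Vec n) (f : L2GL n) :
    StronglyMeasurable fun p : Aff n × orbit n => integrand γ η f p.1 p.2 := by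
  unfold integrand
  have hl := (continuous_lin n).measurable
  have h1 : Measurable fun p : Aff n × orbit n => p.1.lin * γ p.2 :=
    (hl.comp measurable_fst).mul (hγ.comp measurable_snd)
  have h2 : Continuous fun p : Aff n × orbit n =>
      e (-rowCol p.2 (mulCol p.1.lin⁻¹ p.1.vec)) := by
    refine continuous_e.comp (Continuous.neg ?_)
    simp only [rowCol_eq_inner]
    exact (continuous_subtype_val.comp continuous_snd).inner
      ((continuous_mulCol_uncurry (continuous_lin n).inv (continuous_vec n)).comp continuous_fst)
  exact (((Lp.stronglyMeasurable η).comp_measurable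
    (measurable_subtype_coe.comp measurable_snd)).mul
      ((Lp.stronglyMeasurable f).comp_measurable h1)).mul h2.stronglyMeasurable

/-- The phase has modulus one, so on the fibre over `B` integrability does not depend on `y`: either
`φ` is integrable and its unitary transform is the Fourier integral, or the claim is vacuous. -/
lemma IsPartialFourierIntegral.ae_eq_integral {n : ℕ} [NeZero n] {γ : orbit n → GL (Fin n) ℝ}
    (hγ : Measurable γ) {η : L2Vec n} {f : L2GL n} {h : L2Aff n}
    (H : IsPartialFourierIntegral γ η f h) :
    ∀ᵐ g ∂haarAff n, Integrable (integrand γ η f g) (volumeOrbit n) →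
      h g = ∫ ω, integrand γ η f g ω ∂volumeOrbit n := by
  have hm := stronglyMeasurable_integrand hγ η f
  refine ae_haarAff_of_ae_ae ?_ ?_
  · exact MeasurableSet.imp (measurableSet_integrable hm)
      (measurableSet_eq_fun (Lp.stronglyMeasurable h).measurable
        hm.integral_prod_right.measurable)
  · filter_upwards [H] with B ⟨φ, hφ, hy⟩
    have hint : ∀ y, integrand γ η f ⟨y, B⟩ =ᵐ[volumeOrbit n]
        fun ω => φ ω * e (-rowCol ω (mulCol B⁻¹ y)) := by
      intro y
      filter_upwards [hφ] with ω hω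
      rw [hω]
      rfl
    have hemb := MeasurableEmbedding.subtype_coe (measurableSet_orbit n)
    have hmp := measurePreserving_coe_orbit n
    by_cases hφi : Integrable φ
    · filter_upwards [hy, (quasiMeasurePreserving_mulCol B⁻¹).ae
        (fourierTransform_ae_of_integrable φ hφi)] with y ha hb _
      rw [ha, hb, fourier_eq_integral_e, integral_congr_ae (hint y),
        ← hmp.integral_comp hemb (fun ω => φ ω * e (-rowCol ω (mulCol B⁻¹ y)))]
    · refine Filter.Eventually.of_forall fun y hy' => (hφi ?_).elim
      rw [← hmp.integrable_comp_emb hemb]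
      refine (hy'.congr (hint y)).mono
        ((Lp.stronglyMeasurable φ).comp_measurable measurable_subtype_coe).aestronglyMeasurable ?_
      exact Filter.Eventually.of_forall fun ω => by
        rw [norm_mul, norm_e, mul_one, Function.comp_apply]

/-! ### The intertwining relation. -/

lemma rowCol_rowMul {n : ℕ} (ω x : Vec n) (A : GL (Fin n) ℝ) :
    rowCol (rowMul ω A) x = rowCol ω (mulCol A x) := by
  simp [rowCol, rowMul, mulCol, Matrix.dotProduct_mulVec]

lemma quasiMeasurePreserving_affine {n : ℕ} (x : Vec n) (A : GL (Fin n) ℝ) :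
    Measure.QuasiMeasurePreserving (fun y => x + mulCol A y) (volume : Measure (Vec n)) volume := by
  refine ⟨(continuous_const.add (continuous_mulCol A)).measurable, ?_⟩
  rw [map_affine_volume]
  exact Measure.smul_absolutelyContinuous

/-- Partial Fourier integrals intertwine `π^{ω₀}` with left translation. -/
lemma IsPartialFourierIntegral.piRep {n : ℕ} [NeZero n] {γ : orbit n → GL (Fin n) ℝ}
    (hγ : Measurable γ) (hγω : ∀ ω : orbit n, rowMul (omega0 n) (γ ω)⁻¹ = ω)
    {η : L2Vec n} {f : L2GL n} {h : L2Aff n} (H : IsPartialFourierIntegral γ η f h) (g : Aff n) :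
    IsPartialFourierIntegral γ η (piRep (omega0 n) g f) (leftRegular n g h) := by
  have h1 : ∀ᵐ B ∂haarGL n, ∀ᵐ ω : Vec n, piOp (omega0 n) g f (B * extendOrbit γ ω) =
      e (rowCol (omega0 n) (mulCol (B * extendOrbit γ ω)⁻¹ g.vec)) *
        f (g.lin⁻¹ * (B * extendOrbit γ ω)) :=
    ae_ae_snd_of_ae_prod
      ((measurePreserving_shear (measurable_extendOrbit hγ)).quasiMeasurePreserving.ae
        (Measure.quasiMeasurePreserving_snd.ae (piOp_ae (omega0 n) g f)))
  -- For `g = [x, A]`, the hypothesis `H` is used at `A⁻¹ B`; the function for the translate at `B`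
  -- is that `φ` modulated by `u = B⁻¹ x`.
  filter_upwards [h1, (measurePreserving_mul_left (haarGL n) g.lin⁻¹).quasiMeasurePreserving.ae H,
    ae_ae_of_ae_haarAff (leftTranslate_ae g h)] with B hB ⟨φ, hφ, hy⟩ hl
  set u := mulCol B⁻¹ g.vec with hu
  refine ⟨mulUnimodular volume (fun ω => e (rowCol ω u)) (continuous_e_rowCol u).measurable
    (fun _ => norm_e _) φ, ?_, ?_⟩
  · filter_upwards [hφ, ae_volumeOrbit_iff.2 hB, ae_volumeOrbit_iff.2 (MemLp.coeFn_toLp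
      (memLp_mul (continuous_e_rowCol u).measurable (fun _ => norm_e _) φ))] with ω ha hb hc
    rw [extendOrbit_coe] at hb
    -- `ω₀ (B γ(ω))⁻¹ x = (ω₀ γ(ω)⁻¹) B⁻¹ x = ω u`.
    have hph : rowCol (omega0 n) (mulCol (B * γ ω)⁻¹ g.vec) = rowCol ω u := by
      rw [mul_inv_rev, mulCol_mul, ← rowCol_rowMul, hγω]
    refine hc.trans ?_
    change _ = η ω * piOp (omega0 n) g f (B * γ ω)
    rw [hb, hph, ha, ← mul_assoc g.lin⁻¹, mul_left_comm]
  · rw [fourierTransform_mulUnimodular]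
    filter_upwards [hl, (quasiMeasurePreserving_affine (-mulCol g.lin⁻¹ g.vec) g.lin⁻¹).ae hy,
      (quasiMeasurePreserving_mulCol B⁻¹).ae (Lp.coeFn_compMeasurePreserving
        (Lp.fourierTransformₗᵢ (Vec n) ℂ φ) (measurePreserving_sub_right volume u))] with y ha hb hc
    refine ha.trans (Eq.trans ?_ hc.symm)
    refine hb.trans ?_
    rw [Function.comp_apply]
    congr 1
    -- Since `g⁻¹ [y, B] = [A⁻¹ (y - x), A⁻¹ B]`, the transform is evaluated at `(A⁻¹ B)⁻¹ A⁻¹ (y -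
    -- x) = B⁻¹ y - u`.
    rw [mul_inv_rev, inv_inv, mulCol_mul, mulCol_add, mulCol_neg, mulCol_mulCol_inv,
      mulCol_mulCol_inv, mulCol_add, mulCol_neg, hu]
    abel

end AffineGroup

end

/-! ### The decomposition of `L²(G_n)`. -/

theorem mainTheorem4 (n : ℕ) [NeZero n]
    (γ : orbit n → GL (Fin n) ℝ) (hγ : Measurable γ)
    (hγω : ∀ ω : orbit n, rowMul (omega0 n) (γ ω)⁻¹ = ω)
    {J : Type*} (η : HilbertBasis J ℂ (L2Vec n)) :
    ∃ U : J → (L2GL n →ₗᵢ[ℂ] L2Aff n),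
      -- `U j f` is the partial Fourier integral of the theorem, and nothing else is
      (∀ j f h, IsPartialFourierIntegral γ (η j) f h ↔ h = U j f) ∧
      -- where the integral converges absolutely, `U j f` is its value
      (∀ j f, ∀ᵐ g ∂haarAff n, Integrable (integrand γ (η j) f g) (volumeOrbit n) →
        U j f g = ∫ ω, integrand γ (η j) f g ω ∂volumeOrbit n) ∧
      -- `U j` intertwines the two representations
      (∀ j g f, U j (piRep (omega0 n) g f) = leftRegular n g (U j f)) ∧
      -- the ranges are closed and invariant
      (∀ j, IsClosed (Set.range (U j)) ∧
        ∀ g, ∀ h ∈ Set.range (U j), leftRegular n g h ∈ Set.range (U j)) ∧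
      -- `L²(G_n)` is the orthogonal direct sum of the ranges
      IsHilbertSum ℂ (fun j => LinearMap.range (U j).toLinearMap)
        (fun j => (LinearMap.range (U j).toLinearMap).subtypeₗᵢ) := by
  have : Countable J := countable_of_orthonormal η.orthonormal
  obtain ⟨W, hW⟩ := exists_isometry_isPartialFourierIntegral hγ
  let U : J → (L2GL n →ₗᵢ[ℂ] L2Aff n) := fun j =>
    W.toLinearIsometry.comp (tensorLeft (haarGL n) (η j) (η.orthonormal.1 j))
  have hU : ∀ j f, IsPartialFourierIntegral γ (η j) f (U j f) := fun j f => hW (η j) f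
  -- Both sides are partial Fourier integrals of the same function `π^{ω₀}(g) f`, so uniqueness
  -- identifies them.
  have hUπ : ∀ j g f, U j (piRep (omega0 n) g f) = leftRegular n g (U j f) := fun j g f =>
    (hU j _).unique ((hU j f).piRep hγ hγω g)
  refine ⟨U, fun j f h => ⟨fun H => H.unique (hU j f), fun H => H ▸ hU j f⟩,
    fun j f => (hU j f).ae_eq_integral hγ, hUπ, fun j => ⟨?_, ?_⟩, ?_⟩
  · exact (U j).isometry.isClosedEmbedding.isClosed_range
  · rintro g _ ⟨f, rfl⟩
    exact ⟨piRep (omega0 n) g f, hUπ j g f⟩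
  · exact isHilbertSum_range_comp (isHilbertSum_tensorLeft η) W fun _ _ => rfl
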